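/- Notation. $\mathbb N=\{1,2,\dots\}$. For $S\subset\mathbb R^2$, $\Sigma^{\alpha,\beta}(S)$ is the set of functions $a(\xi,\eta)$ that are smooth on a neighbourhood of $S$ and satisfy, for all $j,k\ge 0$, $|\partial_\xi^j\partial_\eta^k a(\xi,\eta)|\le C_{j,k}(1+|\xi|)^{\alpha-j}(1+|\eta|)^{\beta-k}$ on $S$; such an $a$ is positive elliptic if moreover $a\ge c(1+|\xi|)^{\alpha}(1+|\eta|)^{\beta}$ on $S$ for some $c>0$. A classical symbol of degree $0$ on $\mathbb R^n$ is a smooth complex-valued function $a$ with $|\partial^\alpha a(\omega)|\le C_\alpha(1+|\omega|)^{-|\alpha|}$ for all $\alpha$ that has an asymptotic expansion $a\sim\sum_{j\ge0}a_j$ with $a_j$ positively homogeneous of degree $-j$ and smooth away from the origin. Let $\psi$ be a classical symbol of degree $0$ on $\mathbb R$ supported in $\xi\ge 0$, let $\chi$ be a classical symbol of degree $0$ on $\mathbb R^2$ supported in the cone $|\xi|\le\kappa_1\eta$, and let $S$ be the support of $\psi(\xi)\chi(\xi,\eta)$. Let $G$ be a real-valued function in $\Sigma^{2/3,1/3}(S)$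 such that $\partial_\eta G$ is positive elliptic in $\Sigma^{2/3,-2/3}(S)$. Consider the series $$Z(t)=\sum_{(m,n)\in\mathbb Z^2}\psi(m)\,\chi(m,n)\,e^{it(n+G(m,n))}.$$ **Theorem.** (i) For every $C_0$ there is $\kappa_0>0$, depending only on $C_0$, such that if $\kappa_1\le\kappa_0$ and $|G|\le C_0(1+|\xi|)^{2/3}(1+|\eta|)^{1/3}$ on $S$, then the series converges unconditionally, when tested against test functions, to a distribution $Z$ on $\mathbb R$. (ii) For every $T>0$ and every $C$ there exist $\varepsilon>0$ and $\kappa>0$, depending only on $T$ and $C$, such that the following holds for all $\psi,\chi,G$ as above with $\kappa_1\le\kappa$ and $|\partial_\eta G|\le C(1+|\xi|)^{2/3}(1+|\eta|)^{-2/3}$ on $S$, and for which the series defines a distribution $Z$ on $\mathbb R$ (in the sense of (i)): a) if $T=2\pi\ell$ with $\ell\in\mathbb N$, then $Z$ is smooth on $[T,T+\varepsilon)$, that is, on $(T,T+\varepsilon)$ the distribution $Z$ is a function that extends to a $C^\infty$ function on $[T,T+\varepsilon)$; b) if $T\notin 2\pi\mathbb N$, then $Z$ is smooth on $(T-\varepsilon,T+\varepsilon)$.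 -/

import Mathlib

open Set TopologicalSpace MeasureTheory
open scoped ContDiff Distributions

noncomputable section

/-- Hörmander symbols of order `m` on a normed space `E` (here `ℝ` or `ℝ × ℝ`):
`|∂^α a(w)| ≤ C_α (1 + |w|)^(m - |α|)` for all multi-indices `α`; the partial derivatives of
order `k` are controlled together by the `k`-th Fréchet derivative.  All norms on a
finite-dimensional `E` give the same class. -/
def IsSymbol {E : Type*} [NormedAddCommGroup E] [NormedSpace ℝ E] (m : ℝ) (a : E → ℂ) : Prop :=
  ContDiff ℝ ∞ a ∧
    ∀ k : ℕ, ∃ C : ℝ, ∀ w : E, ‖iteratedFDeriv ℝ k a w‖ ≤ C * (1 + ‖w‖) ^ (m - k)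

/-- Classical symbols of order `m`: symbols with an asymptotic expansion `a ∼ ∑ b_j`, where `b_j`
is smooth away from the origin and positively homogeneous of degree `m - j`. -/
def IsClassicalSymbol {E : Type*} [NormedAddCommGroup E] [NormedSpace ℝ E]
    (m : ℝ) (a : E → ℂ) : Prop :=
  IsSymbol m a ∧
    ∃ b : ℕ → E → ℂ,
      (∀ j, ContDiffOn ℝ ∞ (b j) {0}ᶜ ∧
        ∀ (r : ℝ) (w : E), 0 < r → w ≠ 0 → b j (r • w) = (r ^ (m - j) : ℝ) • b j w) ∧
      ∀ N : ℕ, ∃ θ : E → ℝ, ContDiff ℝ ∞ θ ∧ (∃ R : ℝ, ∀ w, R ≤ ‖w‖ → θ w = 1) ∧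
        IsSymbol (m - N - 1) (fun w => θ w • (a w - ∑ j ∈ Finset.range (N + 1), b j w))

/-- The partial derivative `∂_ξ` of a function of `(ξ, η)`. -/
def partialXi (a : ℝ × ℝ → ℝ) (p : ℝ × ℝ) : ℝ := fderiv ℝ a p (1, 0)

/-- The partial derivative `∂_η` of a function of `(ξ, η)`. -/
def partialEta (a : ℝ × ℝ → ℝ) (p : ℝ × ℝ) : ℝ := fderiv ℝ a p (0, 1)

/-- The product type class `Σ^{α,β}(S)`: the function is smooth on a neighbourhood of `S`, and
`|∂_ξ^j ∂_η^k a| ≤ C_{j,k} (1 + |ξ|)^(α - j) (1 + |η|)^(β - k)` at every point of `S`. -/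
def IsProductSymbolOn (α β : ℝ) (S : Set (ℝ × ℝ)) (a : ℝ × ℝ → ℝ) : Prop :=
  (∃ U : Set (ℝ × ℝ), IsOpen U ∧ S ⊆ U ∧ ContDiffOn ℝ ∞ a U) ∧
    ∀ j k : ℕ, ∃ C : ℝ, ∀ p ∈ S,
      |(partialXi^[j] (partialEta^[k] a)) p|
        ≤ C * (1 + |p.1|) ^ (α - j) * (1 + |p.2|) ^ (β - k)

/-- Positive elliptic elements of `Σ^{α,β}(S)`. -/
def IsPositiveEllipticOn (α β : ℝ) (S : Set (ℝ × ℝ)) (a : ℝ × ℝ → ℝ) : Prop :=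
  IsProductSymbolOn α β S a ∧
    ∃ c : ℝ, 0 < c ∧ ∀ p ∈ S, c * (1 + |p.1|) ^ α * (1 + |p.2|) ^ β ≤ a p

/-- The (closed) support of the amplitude `(ξ, η) ↦ ψ(ξ) χ(ξ, η)`. -/
def amplitudeSupport (ψ : ℝ → ℂ) (χ : ℝ × ℝ → ℂ) : Set (ℝ × ℝ) :=
  tsupport (fun p : ℝ × ℝ => ψ p.1 * χ p)

/-- The standing assumptions on the cut-offs `ψ`, `χ` and the phase `n + G(m, n)`, with `χ`
supported in the cone `|ξ| ≤ κ η`. -/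
structure IsLatticeSumData (κ : ℝ) (ψ : ℝ → ℂ) (χ : ℝ × ℝ → ℂ) (G : ℝ × ℝ → ℝ) : Prop where
  psi_classical : IsClassicalSymbol 0 ψ
  psi_support : tsupport ψ ⊆ Ici 0
  chi_classical : IsClassicalSymbol 0 χ
  chi_support : tsupport χ ⊆ {p : ℝ × ℝ | |p.1| ≤ κ * p.2}
  G_symbol : IsProductSymbolOn (2 / 3) (1 / 3) (amplitudeSupport ψ χ) G
  dG_elliptic : IsPositiveEllipticOn (2 / 3) (-2 / 3) (amplitudeSupport ψ χ) (partialEta G)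

/-- `Z(t) = ∑_{(m,n) ∈ ℤ²} ψ(m) χ(m,n) exp(i t (n + G(m,n)))` as a distribution on `ℝ`:
tested against any `φ`, the series converges unconditionally to `Z φ`. -/
def IsLatticeSum (Z : 𝓓'((⊤ : Opens ℝ), ℂ)) (ψ : ℝ → ℂ) (χ : ℝ × ℝ → ℂ)
    (G : ℝ × ℝ → ℝ) : Prop :=
  ∀ φ : 𝓓((⊤ : Opens ℝ), ℝ),
    HasSum (fun mn : ℤ × ℤ =>
      ψ (mn.1 : ℝ) * χ ((mn.1 : ℝ), (mn.2 : ℝ)) *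
        ∫ t : ℝ, (φ t : ℂ) *
          Complex.exp (Complex.I * ((t * ((mn.2 : ℝ) + G ((mn.1 : ℝ), (mn.2 : ℝ))) : ℝ) : ℂ)))
      (Z φ)

/-- A distribution on `ℝ` is smooth on the interval `J` if in the interior of `J` it is given by
a function which is `C^∞` on `J`, up to those end points that belong to `J`. -/
def DistributionSmoothOn (Z : 𝓓'((⊤ : Opens ℝ), ℂ)) (J : Set ℝ) : Prop :=
  ∃ f : ℝ → ℂ, ContDiffOn ℝ ∞ f J ∧
    ∀ φ : 𝓓((⊤ : Opens ℝ), ℝ), tsupport φ ⊆ interior J → Z φ = ∫ t : ℝ, (φ t : ℂ) * f t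

end

/-! For fixed `m`, Poisson summation in `n` turns the row into a sum over `k ∈ ℤ` of integrals with
phase `t (η + G(m,η)) - 2πkη`, whose `η`-derivative is `t (1 + s) - 2πk` with `s = ∂_η G(m,η)`.
Ellipticity makes `s` positive, and in a thin cone `s = O((m/η)^{2/3})` is uniformly small. For `t`
near `T` the only dangerous `k` is the one with `2πk = T`, and for it `t (1 + s) - T ≥ T s` as soon
as `t ≥ T`. So there are no stationary points: `exists_le_abs_mul_one_add_sub` bounds the phase
derivative below by `δ s (1 + |k|)`, on both sides of `T` if `T ∉ 2πℕ`.

This lower bound may degenerate at infinity, but only as fast as `s ≥ c (1 + η)^{-2/3}`. On a dyadic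
window `η ∼ R` an integration by parts costs `1/R` and gains the inverse of the phase derivative,
for a net factor `O(R^{-1/3} (1 + |k|)^{-1})`. The higher derivatives of the phase are dominated by
`s` itself, so they do not spoil the gain (`norm_integral_mul_le_of_nonstationary`,
`exists_norm_tsum_block_le`). Sufficiently many integrations absorb the factor `R^p` coming from `p`
derivatives in `t` and the `O(R)` rows of the block. The dyadic blocks and all their `t`-derivatives
then sum geometrically, uniformly up to the end point, and `contDiffOn_tsum_Ico` gives smoothness
there.

For the convergence in (i), a thin cone forces `|G| ≤ n/2`, so the frequency `n + G` is at least
`n/2`. Four integrations by parts in `t` against a test function give a summable bound on the terms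
(`exists_norm_latticeTerm_le`). -/

/-! ### Derivative bounds and non-stationary phase in one variable. -/

/-- The derivatives of `f` at `x` up to order `N` are bounded by `M`, in units of length `1 / r`. -/
def DerivBound (N : ℕ) (r M : ℝ) (f : ℝ → ℂ) (x : ℝ) : Prop :=
  ∀ j ≤ N, ‖iteratedDeriv j f x‖ ≤ M * r ^ j

theorem DerivBound.mul {N : ℕ} {r A B x : ℝ} {f g : ℝ → ℂ} (hr : 0 ≤ r)
    (hf : ContDiffAt ℝ ∞ f x) (hg : ContDiffAt ℝ ∞ g x)
    (hA : DerivBound N r A f x) (hB : DerivBound N r B g x) :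
    DerivBound N r (2 ^ N * A * B) (fun y => f y * g y) x := by
  have hA0 : 0 ≤ A := by simpa using (norm_nonneg _).trans (hA 0 (Nat.zero_le _))
  have hB0 : 0 ≤ B := by simpa using (norm_nonneg _).trans (hB 0 (Nat.zero_le _))
  intro j hj
  rw [iteratedDeriv_fun_mul (hf.of_le (mod_cast le_top)) (hg.of_le (mod_cast le_top))]
  calc ‖∑ i ∈ Finset.range (j + 1), (j.choose i : ℂ) * iteratedDeriv i f x
        * iteratedDeriv (j - i) g x‖
      ≤ ∑ i ∈ Finset.range (j + 1), (j.choose i : ℝ) * (A * B * r ^ j) := by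
        refine norm_sum_le_of_le _ fun i hi => ?_
        have hij : i ≤ j := Nat.lt_succ_iff.1 (Finset.mem_range.1 hi)
        rw [norm_mul, norm_mul, Complex.norm_natCast, mul_assoc]
        refine mul_le_mul_of_nonneg_left ?_ (Nat.cast_nonneg _)
        calc _ ≤ (A * r ^ i) * (B * r ^ (j - i)) :=
              mul_le_mul (hA i (hij.trans hj)) (hB _ ((Nat.sub_le _ _).trans hj))
                (norm_nonneg _) (by positivity)
          _ = A * B * (r ^ i * r ^ (j - i)) := by ring
          _ = A * B * r ^ j := by rw [← pow_add, Nat.add_sub_cancel' hij]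
    _ = 2 ^ j * (A * B * r ^ j) := by
        rw [← Finset.sum_mul]
        congr 1
        exact_mod_cast Nat.sum_range_choose j
    _ ≤ 2 ^ N * (A * B * r ^ j) := by gcongr; norm_num
    _ = _ := by ring

/-- Derivative bounds for a quotient, in a form that does not mention division. -/
theorem DerivBound.of_mul {N : ℕ} {r A M x : ℝ} {u θ : ℝ → ℂ} (hr : 0 ≤ r) (hA : 0 ≤ A)
    (hM : 0 ≤ M) (hu : ContDiffAt ℝ ∞ u x) (hθ : ContDiffAt ℝ ∞ θ x) (hθ0 : θ x ≠ 0)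
    (hb : DerivBound N r M (fun y => u y * θ y) x) (hθb : DerivBound N r (A * ‖θ x‖) θ x) :
    DerivBound N r ((1 + A * 2 ^ N) ^ N * (M / ‖θ x‖)) u x := by
  have hθp : 0 < ‖θ x‖ := norm_pos_iff.2 hθ0
  -- This `Q` satisfies `A 2^N Q^(j-1) ≤ Q^j - 1` for `j ≥ 1`, which closes the Leibniz recursion
  -- for the derivatives of the quotient.
  set Q : ℝ := 1 + A * 2 ^ N with hQ
  have hQ1 : 1 ≤ Q := by rw [hQ]; linarith [show 0 ≤ A * 2 ^ N by positivity]
  have key : ∀ j ≤ N, ‖iteratedDeriv j u x‖ ≤ Q ^ j * (M / ‖θ x‖) * r ^ j := by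
    intro j
    induction j using Nat.strong_induction_on with
    | _ j ih =>
    intro hj
    have h1 := iteratedDeriv_fun_mul (n := j) (hu.of_le (mod_cast le_top))
      (hθ.of_le (mod_cast le_top))
    rw [Finset.sum_range_succ] at h1
    simp only [Nat.choose_self, Nat.cast_one, one_mul, Nat.sub_self, iteratedDeriv_zero] at h1
    have h2 : iteratedDeriv j u x * θ x = iteratedDeriv j (fun y => u y * θ y) x
        - ∑ i ∈ Finset.range j, (j.choose i : ℂ) * iteratedDeriv i u x
          * iteratedDeriv (j - i) θ x := by rw [h1]; ring
    have h3 : ‖∑ i ∈ Finset.range j, (j.choose i : ℂ) * iteratedDeriv i u x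
          * iteratedDeriv (j - i) θ x‖ ≤
        ∑ i ∈ Finset.range j, (j.choose i : ℝ) * (A * Q ^ (j - 1) * M * r ^ j) := by
      refine norm_sum_le_of_le _ fun i hi => ?_
      have hij : i < j := Finset.mem_range.1 hi
      rw [norm_mul, norm_mul, Complex.norm_natCast, mul_assoc]
      refine mul_le_mul_of_nonneg_left ?_ (Nat.cast_nonneg _)
      calc _ ≤ (Q ^ i * (M / ‖θ x‖) * r ^ i) * (A * ‖θ x‖ * r ^ (j - i)) :=
            mul_le_mul (ih i hij (hij.le.trans hj)) (hθb _ ((Nat.sub_le _ _).trans hj))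
              (norm_nonneg _) (by positivity)
        _ = A * Q ^ i * M * (r ^ i * r ^ (j - i)) := by field_simp
        _ = A * Q ^ i * M * r ^ j := by rw [← pow_add, Nat.add_sub_cancel' hij.le]
        _ ≤ A * Q ^ (j - 1) * M * r ^ j := by
            gcongr
            omega
    have h4 : ∑ i ∈ Finset.range j, (j.choose i : ℝ) * (A * Q ^ (j - 1) * M * r ^ j)
        ≤ (Q ^ j - 1) * M * r ^ j := by
      rcases Nat.eq_zero_or_pos j with rfl | hjp
      · simp
      rw [← Finset.sum_mul]
      have h5 : ∑ i ∈ Finset.range j, (j.choose i : ℝ) ≤ 2 ^ N := by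
        calc ∑ i ∈ Finset.range j, (j.choose i : ℝ)
            ≤ ∑ i ∈ Finset.range (j + 1), (j.choose i : ℝ) := by
              rw [Finset.sum_range_succ]; simp
          _ = 2 ^ j := by exact_mod_cast Nat.sum_range_choose j
          _ ≤ 2 ^ N := pow_le_pow_right₀ (by norm_num) hj
      calc _ ≤ 2 ^ N * (A * Q ^ (j - 1) * M * r ^ j) := by gcongr
        _ = (A * 2 ^ N * Q ^ (j - 1)) * M * r ^ j := by ring
        _ ≤ (Q ^ j - 1) * M * r ^ j := by
            gcongr
            obtain ⟨i, rfl⟩ : ∃ i, j = i + 1 := ⟨j - 1, by omega⟩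
            have : 1 ≤ Q ^ i := one_le_pow₀ hQ1
            simp only [Nat.add_sub_cancel, pow_succ]
            rw [hQ] at this ⊢
            nlinarith
    have h6 : ‖iteratedDeriv j u x‖ * ‖θ x‖ ≤ Q ^ j * M * r ^ j := by
      rw [← norm_mul, h2]
      calc _ ≤ M * r ^ j + (Q ^ j - 1) * M * r ^ j :=
            (norm_sub_le _ _).trans (add_le_add (hb j hj) (h3.trans h4))
        _ = _ := by ring
    calc _ ≤ Q ^ j * M * r ^ j / ‖θ x‖ := (le_div_iff₀ hθp).2 h6
      _ = _ := by ring
  intro j hj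
  refine (key j hj).trans ?_
  gcongr

theorem DerivBound.deriv {N : ℕ} {r M x : ℝ} {f : ℝ → ℂ} (h : DerivBound (N + 1) r M f x) :
    DerivBound N r (M * r) (deriv f) x := by
  intro j hj
  rw [← iteratedDeriv_succ']
  calc _ ≤ M * r ^ (j + 1) := h _ (by omega)
    _ = _ := by ring

theorem DerivBound.mono {N N' : ℕ} {r M M' x : ℝ} {f : ℝ → ℂ} (hr : 0 ≤ r)
    (h : DerivBound N' r M f x) (hN : N ≤ N') (hM : M ≤ M') : DerivBound N r M' f x :=
  fun j hj => (h j (hj.trans hN)).trans (mul_le_mul_of_nonneg_right hM (by positivity))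

theorem contDiff_of_contDiffAt_tsupport {f : ℝ → ℂ} (h : ∀ x ∈ tsupport f, ContDiffAt ℝ ∞ f x) :
    ContDiff ℝ ∞ f := by
  rw [contDiff_iff_contDiffAt]
  intro x
  by_cases hx : x ∈ tsupport f
  · exact h x hx
  · exact contDiffAt_const.congr_of_eventuallyEq (notMem_tsupport_iff_eventuallyEq.1 hx)

/-- The principle of non-stationary phase in one variable.  The oscillating factor `E` satisfies
`E' = Θ E`, and the derivatives of `Θ` are controlled by `Θ`. -/
theorem norm_integral_mul_le_of_nonstationary (N : ℕ) (A : ℝ) (hA : 0 ≤ A) :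
    ∃ D : ℝ, 0 ≤ D ∧ ∀ (K U : Set ℝ) (r l M : ℝ) (Θ E b : ℝ → ℂ), IsCompact K → IsOpen U → K ⊆ U →
      0 ≤ r → 0 < l → 0 ≤ M → ContDiffOn ℝ ∞ Θ U → (∀ x ∈ U, HasDerivAt E (Θ x * E x) x) →
      (∀ x ∈ U, ‖E x‖ ≤ 1) → (∀ x ∈ K, l ≤ ‖Θ x‖) →
      (∀ x ∈ K, DerivBound N r (A * ‖Θ x‖) Θ x) →
      ContDiff ℝ ∞ b → tsupport b ⊆ K → (∀ x ∈ K, DerivBound N r M b x) →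
      ‖∫ x, b x * E x‖ ≤ D * M * (r / l) ^ N * volume.real K := by
  induction N with
  | zero =>
    refine ⟨1, zero_le_one, ?_⟩
    intro K U r l M Θ E b hK hU hKU hr hl hM hΘ hE hE1 hl' hΘb hb hbK hbb
    have h0 : ∀ x ∉ K, b x * E x = 0 := fun x hx => by
      rw [image_eq_zero_of_notMem_tsupport fun h => hx (hbK h), zero_mul]
    rw [← setIntegral_eq_integral_of_forall_compl_eq_zero h0]
    simp only [one_mul, pow_zero, mul_one]
    refine norm_setIntegral_le_of_norm_le_const hK.measure_lt_top fun x hx => ?_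
    have := hbb x hx 0 le_rfl
    simp only [iteratedDeriv_zero, pow_zero, mul_one] at this
    calc ‖b x * E x‖ = ‖b x‖ * ‖E x‖ := norm_mul _ _
      _ ≤ M * 1 := mul_le_mul this (hE1 x (hKU hx)) (norm_nonneg _) hM
      _ = M := mul_one _
  | succ N ih =>
    obtain ⟨D, hD, h⟩ := ih
    set Q : ℝ := (1 + A * 2 ^ (N + 1)) ^ (N + 1) with hQ
    refine ⟨D * Q, by positivity, ?_⟩
    intro K U r l M Θ E b hK hU hKU hr hl hM hΘ hE hE1 hl' hΘb hb hbK hbb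
    have hΘ0 : ∀ x ∈ K, Θ x ≠ 0 := fun x hx h0 => by
      have := hl' x hx; rw [h0, norm_zero] at this; linarith
    have hΘat : ∀ x ∈ K, ContDiffAt ℝ ∞ Θ x := fun x hx => hΘ.contDiffAt (hU.mem_nhds (hKU hx))
    -- Since `b = u Θ` and `E' = Θ E`, one has `∫ b E = ∫ u E' = -∫ u' E`. The new amplitude `u'`
    -- has size `M r / l` up to a constant, at the price of one derivative. Off `K` the numerator
    -- vanishes, so zeros of `Θ` there are harmless.
    set u : ℝ → ℂ := fun x => b x / Θ x with hu
    have hub : ∀ x, u x * Θ x = b x := fun x => by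
      by_cases hx : x ∈ K
      · exact div_mul_cancel₀ _ (hΘ0 x hx)
      · have : b x = 0 := image_eq_zero_of_notMem_tsupport fun h => hx (hbK h)
        simp [hu, this]
    have husupp : tsupport u ⊆ tsupport b :=
      closure_mono fun x hx hb0 => hx (by simp [hu, hb0])
    have hus : ContDiff ℝ ∞ u := contDiff_of_contDiffAt_tsupport fun x hx =>
      by
        simp only [hu, div_eq_mul_inv]
        exact hb.contDiffAt.mul ((hΘat x (hbK (husupp hx))).inv (hΘ0 x (hbK (husupp hx))))
    have hubd : ∀ x ∈ K, DerivBound (N + 1) r (Q * (M / l)) u x := fun x hx => by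
      refine DerivBound.mono hr (DerivBound.of_mul hr hA hM hus.contDiffAt (hΘat x hx) (hΘ0 x hx)
        ?_ (hΘb x hx)) le_rfl ?_
      · simpa only [hub] using hbb x hx
      · gcongr
        exact hl' x hx
    have hdu : ContDiff ℝ ∞ (deriv u) := ((contDiff_infty_iff_deriv).1 hus).2
    have hucs : HasCompactSupport u := hK.of_isClosed_subset (isClosed_tsupport _)
      (husupp.trans hbK)
    have hbcs : HasCompactSupport b := hK.of_isClosed_subset (isClosed_tsupport _) hbK
    have hdusupp : tsupport (deriv u) ⊆ K := (tsupport_deriv_subset (f := u)).trans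
      (husupp.trans hbK)
    -- products with a function supported in `K` are continuous
    have hcont : ∀ w : ℝ → ℂ, Continuous w → tsupport w ⊆ K → Integrable fun x => w x * E x := by
      intro w hw hwK
      refine Continuous.integrable_of_hasCompactSupport ?_
        (HasCompactSupport.mul_right (hK.of_isClosed_subset (isClosed_tsupport _) hwK))
      rw [continuous_iff_continuousAt]
      intro x
      by_cases hx : x ∈ K
      · exact hw.continuousAt.mul (hE x (hKU hx)).continuousAt
      · have : (fun x => w x * E x) =ᶠ[nhds x] fun _ => 0 := by
          filter_upwards [notMem_tsupport_iff_eventuallyEq.1 fun h => hx (hwK h)] with y hy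
          rw [hy]; simp
        exact continuousAt_const.congr this.symm
    have hder : ∀ x, HasDerivAt (fun x => u x * E x) (deriv u x * E x + b x * E x) x := by
      intro x
      by_cases hx : x ∈ K
      · have := ((hus.differentiable (by simp)) x).hasDerivAt.mul (hE x (hKU hx))
        rw [← mul_assoc, hub] at this
        exact this
      · have h1 : u =ᶠ[nhds x] 0 :=
          notMem_tsupport_iff_eventuallyEq.1 fun h => hx (hbK (husupp h))
        have h2 : (fun x => u x * E x) =ᶠ[nhds x] fun _ => 0 := by
          filter_upwards [h1] with y hy
          rw [hy]; simp
        have h3 : b x = 0 := image_eq_zero_of_notMem_tsupport fun h => hx (hbK h)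
        have h4 : deriv u x = 0 := image_eq_zero_of_notMem_tsupport fun h => hx (hdusupp h)
        rw [h3, h4]
        simpa using (hasDerivAt_const x (0 : ℂ)).congr_of_eventuallyEq h2
    have hi1 := hcont _ hdu.continuous hdusupp
    have hi2 := hcont _ hb.continuous hbK
    have hzero := integral_eq_zero_of_hasDerivAt_of_integrable hder (hi1.add hi2)
      (hcont _ hus.continuous (husupp.trans hbK))
    have hsum := integral_add hi1 hi2
    have hbu : ∫ x, b x * E x = - ∫ x, deriv u x * E x := by
      rw [eq_neg_iff_add_eq_zero, add_comm, ← hsum]; exact hzero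
    rw [hbu, norm_neg]
    have := h K U r l (Q * (M / l) * r) Θ E (deriv u) hK hU hKU hr hl (by positivity) hΘ hE hE1 hl'
      (fun x hx => (hΘb x hx).mono hr (Nat.le_succ _) le_rfl) hdu hdusupp
      (fun x hx => (hubd x hx).deriv)
    calc _ ≤ _ := this
      _ = _ := by rw [pow_succ, div_pow]; field_simp

/-! ### Series of functions smooth up to an end point. -/

/-- Sums of series of smooth functions, up to the closed end point of a half-open interval. -/
theorem contDiffOn_tsum_Ico {a b : ℝ} (hab : a < b) {w : ℕ → ℕ → ℝ → ℂ} {u : ℕ → ℕ → ℝ}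
    (hw : ∀ p j t, HasDerivAt (w p j) (w (p + 1) j t) t) (hu : ∀ p, Summable (u p))
    (hb : ∀ p j, ∀ t ∈ Ico a b, ‖w p j t‖ ≤ u p j) :
    ContDiffOn ℝ ∞ (fun t => ∑' j, w 0 j t) (Ico a b) := by
  set f : ℕ → ℝ → ℂ := fun p t => ∑' j, w p j t with hf
  have hsub : Ioo a b ⊆ Ico a b := Ioo_subset_Ico_self
  have hcont : ∀ p, ContinuousOn (f p) (Ico a b) := fun p =>
    continuousOn_tsum (fun j => (continuous_iff_continuousAt.2 fun t =>
      (hw p j t).continuousAt).continuousOn) (hu p) (hb p)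
  have hint : ∀ p, ∀ t ∈ Ioo a b, HasDerivAt (f p) (f (p + 1) t) t := fun p t ht =>
    hasDerivAt_tsum_of_isPreconnected (hu (p + 1)) isOpen_Ioo isPreconnected_Ioo
      (fun j y _ => hw p j y) (fun j y hy => hb (p + 1) j y (hsub hy)) ht
      ((hu p).of_norm_bounded fun j => hb p j t (hsub ht)) ht
  have hder : ∀ p, ∀ t ∈ Ico a b, HasDerivWithinAt (f p) (f (p + 1) t) (Ico a b) t := by
    intro p t ht
    -- At the closed end point termwise differentiation on an open set is not available. The
    -- one-sided derivative exists there because `f p` is continuous up to `a` and its derivative `f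
    -- (p + 1)` has a limit at `a`.
    rcases eq_or_lt_of_le ht.1 with rfl | hat
    · have h1 : HasDerivWithinAt (f p) (f (p + 1) a) (Ici a) a := by
        refine hasDerivWithinAt_Ici_of_tendsto_deriv (s := Ioo a b)
          (fun y hy => (hint p y hy).differentiableAt.differentiableWithinAt)
          ((hcont p a ht).mono hsub) (Ioo_mem_nhdsGT hab) ?_
        have h2 : Filter.Tendsto (f (p + 1)) (nhdsWithin a (Ioi a)) (nhds (f (p + 1) a)) := by
          rw [← nhdsWithin_Ioo_eq_nhdsGT hab]
          exact ((hcont (p + 1) a ht).mono hsub)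
        refine h2.congr' ?_
        filter_upwards [Ioo_mem_nhdsGT hab] with y hy
        exact (hint p y hy).deriv.symm
      exact h1.mono Ico_subset_Ici_self
    · exact (hint p t ⟨hat, ht.2⟩).hasDerivWithinAt
  have hall : ∀ n : ℕ, ∀ p, ContDiffOn ℝ n (f p) (Ico a b) := by
    intro n
    induction n with
    | zero => exact fun p => contDiffOn_zero.2 (hcont p)
    | succ n ih =>
      intro p
      rw [Nat.cast_add, Nat.cast_one, contDiffOn_succ_iff_derivWithin (uniqueDiffOn_Ico a b)]
      refine ⟨fun t ht => (hder p t ht).differentiableWithinAt, by simp, ?_⟩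
      exact (ih (p + 1)).congr fun t ht =>
        (hder p t ht).derivWithin (uniqueDiffOn_Ico a b t ht)
  exact contDiffOn_infty.2 fun n => hall n 0

/-! ### Distance of the phase derivative from zero. -/

/-- Only the integer nearest to `τ = T / 2π` can make the difference small, and a single integer
costs only a constant. Every other `k` has `|τ - k| ≥ 1/2`, and then `1 + |k| ≤ (3 + 2τ) |τ - k|`.
-/
theorem exists_le_abs_sub_two_pi_mul {T : ℝ} (hT : 0 < T) :
    ∃ δ : ℝ, 0 < δ ∧ ∀ k : ℤ, 2 * Real.pi * k ≠ T →
      δ * (1 + |(k : ℝ)|) ≤ |T - 2 * Real.pi * k| := by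
  have hpi := Real.pi_gt_three
  set τ : ℝ := T / (2 * Real.pi) with hτ
  have hτ0 : 0 < τ := by positivity
  have hTτ : T = 2 * Real.pi * τ := by rw [hτ]; field_simp
  have hfac : ∀ k : ℤ, |T - 2 * Real.pi * k| = 2 * Real.pi * |τ - k| := fun k => by
    rw [hTτ, ← mul_sub, abs_mul, abs_of_pos (by positivity)]
  set q : ℤ := round τ with hq
  set d : ℝ := if 2 * Real.pi * q = T then 1 else |T - 2 * Real.pi * q| / (1 + |(q : ℝ)|) with hd
  have hd0 : 0 < d := by
    rw [hd]
    split_ifs with h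
    · exact one_pos
    · have : 0 < |T - 2 * Real.pi * q| := abs_pos.2 (sub_ne_zero.2 fun h' => h h'.symm)
      positivity
  refine ⟨min d (1 / (3 + 2 * τ)), by positivity, fun k hk => ?_⟩
  by_cases hkq : k = q
  · subst hkq
    have : d = |T - 2 * Real.pi * q| / (1 + |(q : ℝ)|) := by rw [hd, if_neg hk]
    calc _ ≤ d * (1 + |(q : ℝ)|) := by gcongr; exact min_le_left _ _
      _ = _ := by rw [this]; field_simp
  · have h1 : (1 : ℝ) / 2 ≤ |τ - k| := by
      have h2 := abs_sub_round τ
      have h3 : (1 : ℝ) ≤ |(k : ℝ) - q| := by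
        have : 1 ≤ |k - q| := Int.one_le_abs (sub_ne_zero.2 hkq)
        exact_mod_cast this
      have h4 : |(k : ℝ) - q| ≤ |τ - k| + |τ - q| := by
        rw [abs_sub_comm τ k]
        exact abs_sub_le _ _ _
      linarith
    have h5 : |(k : ℝ)| ≤ |τ - k| + τ := by
      have := abs_sub_abs_le_abs_sub (k : ℝ) τ
      rw [abs_of_pos hτ0, abs_sub_comm] at this
      linarith
    rw [hfac]
    calc _ ≤ 1 / (3 + 2 * τ) * (1 + |(k : ℝ)|) := by gcongr; exact min_le_right _ _
      _ ≤ 1 / (3 + 2 * τ) * ((3 + 2 * τ) * |τ - k|) := by gcongr; nlinarith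
      _ = 1 * |τ - k| := by field_simp
      _ ≤ 2 * Real.pi * |τ - k| := by gcongr; linarith

/-- Near `T`, and to its right if `T ∈ 2πℤ`, the numbers `t (1 + s)` with small `s > 0` stay away
from `2πℤ`, at a distance proportional to `s`. -/
theorem exists_le_abs_mul_one_add_sub {T : ℝ} (hT : 0 < T) :
    ∃ ε σ δ : ℝ, 0 < ε ∧ ε < T ∧ 0 < σ ∧ σ ≤ 1 ∧ 0 < δ ∧ ∀ t s : ℝ, T - ε ≤ t → t < T + ε →
      0 < s → s ≤ σ → ∀ k : ℤ, (2 * Real.pi * k = T → T ≤ t) →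
        δ * s * (1 + |(k : ℝ)|) ≤ |t * (1 + s) - 2 * Real.pi * k| := by
  obtain ⟨d, hd, h⟩ := exists_le_abs_sub_two_pi_mul hT
  -- With these `ε` and `σ`, `|t - T| ≤ d/4` and `t s ≤ (T + 1) s ≤ d/4`, so `t (1 + s)` stays
  -- within `d/2` of `T`. The bound `ε ≤ T/2` keeps `t` positive.
  refine ⟨min (min (d / 4) 1) (T / 2), min 1 (d / (4 * (T + 1))), min (d / 2) (T / (1 + T)),
    by positivity, by linarith [min_le_right (min (d / 4) 1) (T / 2)], by positivity,
    min_le_left _ _, by positivity, fun t s h1 h2 hs hsσ k hk => ?_⟩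
  set ε := min (min (d / 4) 1) (T / 2) with hε
  have hε1 : ε ≤ d / 4 := (min_le_left _ _).trans (min_le_left _ _)
  have hε2 : ε ≤ 1 := (min_le_left _ _).trans (min_le_right _ _)
  have hε3 : ε ≤ T / 2 := min_le_right _ _
  have hs1 : s ≤ 1 := hsσ.trans (min_le_left _ _)
  have hs2 : s * (4 * (T + 1)) ≤ d := by
    rw [← le_div_iff₀ (by positivity)]; exact hsσ.trans (min_le_right _ _)
  -- The resonant `k` is the reason for the one-sided interval: for `t ≥ T` the shift `s` pushes `t
  -- (1 + s)` further from `T`, whereas for `t < T` it could bring it back onto `T`. For the other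
  -- `k`, half of the gap at `T` survives.
  by_cases hkT : 2 * Real.pi * k = T
  · have hTt := hk hkT
    have hk0 : |(k : ℝ)| ≤ T := by
      have hpi := Real.pi_gt_three
      have : 0 < (k : ℝ) := by
        by_contra h0
        nlinarith
      rw [abs_of_pos this]
      nlinarith
    rw [hkT]
    calc _ ≤ T / (1 + T) * s * (1 + T) := by gcongr; exact min_le_right _ _
      _ = T * s := by field_simp
      _ ≤ t * (1 + s) - T := by nlinarith
      _ ≤ _ := le_abs_self _
  · have h3 := h k hkT
    have h4 : |T - t * (1 + s)| ≤ d / 2 := by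
      rw [abs_le]
      constructor <;> nlinarith
    have h5 : |T - 2 * Real.pi * k| ≤ |T - t * (1 + s)| + |t * (1 + s) - 2 * Real.pi * k| :=
      abs_sub_le _ _ _
    have h6 : 0 ≤ |(k : ℝ)| := abs_nonneg _
    calc _ ≤ d / 2 * 1 * (1 + |(k : ℝ)|) := by gcongr; exact min_le_left _ _
      _ ≤ d * (1 + |(k : ℝ)|) - d / 2 := by nlinarith
      _ ≤ _ := by linarith

/-! ### Poisson summation and the dyadic partition. -/

/-- Poisson summation as an upper bound. -/
theorem norm_tsum_int_le_of_fourier {F : ℝ → ℂ} (hF : ContDiff ℝ ∞ F) (hFc : HasCompactSupport F)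
    {B : ℤ → ℝ} (hB : Summable B)
    (h : ∀ k : ℤ, ‖∫ x : ℝ, Complex.exp (↑(-2 * Real.pi * x * k) * Complex.I) • F x‖ ≤ B k) :
    ‖∑' n : ℤ, F n‖ ≤ ∑' k, B k := by
  have h1 := SchwartzMap.tsum_eq_tsum_fourier (hFc.toSchwartzMap hF) 0
  have h2 : ∑' n : ℤ, F n = ∑' k : ℤ,
      ∫ x : ℝ, Complex.exp (↑(-2 * Real.pi * x * k) * Complex.I) • F x := by
    simpa [SchwartzMap.fourier_coe, Real.fourier_real_eq_integral_exp_smul] using h1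
  rw [h2]
  exact tsum_of_norm_bounded hB.hasSum h

/-- A smooth cut-off: `1` for `x ≤ 1` and `0` for `2 ≤ x`. -/
noncomputable def smoothCutoff (x : ℝ) : ℝ := Real.smoothTransition (2 - x)

/-- The dyadic window `smoothCutoff x - smoothCutoff (2 x)`, supported in `[1/2, 2]`. -/
noncomputable def dyadicWindow (x : ℝ) : ℝ := smoothCutoff x - smoothCutoff (2 * x)

theorem smoothCutoff_of_le_one {x : ℝ} (hx : x ≤ 1) : smoothCutoff x = 1 :=
  Real.smoothTransition.one_of_one_le (by linarith)

theorem smoothCutoff_of_two_le {x : ℝ} (hx : 2 ≤ x) : smoothCutoff x = 0 :=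
  Real.smoothTransition.zero_of_nonpos (by linarith)

theorem norm_smoothCutoff_le_one (x : ℝ) : ‖smoothCutoff x‖ ≤ 1 := by
  rw [smoothCutoff, Real.norm_of_nonneg (Real.smoothTransition.nonneg _)]
  exact Real.smoothTransition.le_one _

theorem contDiff_smoothCutoff : ContDiff ℝ ∞ smoothCutoff :=
  Real.smoothTransition.contDiff.comp (contDiff_const.sub contDiff_id)

theorem contDiff_dyadicWindow : ContDiff ℝ ∞ dyadicWindow :=
  contDiff_smoothCutoff.sub (contDiff_smoothCutoff.comp (contDiff_const.mul contDiff_id))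

theorem dyadicWindow_of_notMem {x : ℝ} (hx : x ∉ Icc (1 / 2 : ℝ) 2) : dyadicWindow x = 0 := by
  rw [mem_Icc, not_and_or, not_le, not_le] at hx
  rcases hx with hx | hx
  · rw [dyadicWindow, smoothCutoff_of_le_one (by linarith), smoothCutoff_of_le_one (by linarith),
      sub_self]
  · rw [dyadicWindow, smoothCutoff_of_two_le (by linarith), smoothCutoff_of_two_le (by linarith),
      sub_self]

/-- The sum telescopes, and `1 ≤ x` kills the lower end `smoothCutoff (2 * x)`. -/
theorem sum_range_dyadicWindow {x : ℝ} (hx : 1 ≤ x) (J : ℕ) :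
    ∑ j ∈ Finset.range (J + 1), dyadicWindow (x / 2 ^ j) = smoothCutoff (x / 2 ^ J) := by
  induction J with
  | zero => simp [dyadicWindow, smoothCutoff_of_two_le (show 2 ≤ 2 * x by linarith)]
  | succ J ih =>
    rw [Finset.sum_range_succ, ih, dyadicWindow, pow_succ,
      show 2 * (x / (2 ^ J * 2)) = x / 2 ^ J by field_simp]
    ring

theorem summable_int_inv_one_add_abs_sq : Summable fun k : ℤ => ((1 + |(k : ℝ)|) ^ 2)⁻¹ := by
  have h : Summable fun n : ℕ => ((1 + (n : ℝ)) ^ 2)⁻¹ := by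
    have := (summable_nat_add_iff 1).2 (Real.summable_nat_pow_inv.2 one_lt_two)
    simpa [add_comm] using this
  refine Summable.of_nat_of_neg ?_ ?_ <;> simpa using h

/-! ### Slices and their derivative bounds at scale `R`. -/

/-- One-dimensional slice of the amplitude and of the phase: `a` is a symbol of order `0` supported
in `S`, `g k` is the `k`-th derivative of the phase, and `g 1` dominates the higher ones. -/
structure IsPhaseSlice (c σ : ℝ) (Ca Cg : ℕ → ℝ) (S U : Set ℝ) (a : ℝ → ℂ) (g : ℕ → ℝ → ℝ) :
    Prop where
  isClosed : IsClosed S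
  isOpen : IsOpen U
  subset : S ⊆ U
  contDiff_amp : ContDiff ℝ ∞ a
  tsupport_amp : tsupport a ⊆ S
  contDiffOn_phase : ContDiffOn ℝ ∞ (g 0) U
  hasDerivAt_phase : ∀ k, ∀ x ∈ U, HasDerivAt (g k) (g (k + 1) x) x
  amp_le : ∀ k, ∀ x ∈ S, ‖iteratedDeriv k a x‖ * (1 + |x|) ^ k ≤ Ca k
  phase_le : ∀ k, ∀ x ∈ S, |g k x| * (1 + |x|) ^ k ≤ Cg k * (1 + |x|) * g 1 x
  le_deriv : ∀ x ∈ S, c * (1 + |x|) ^ (-2 / 3 : ℝ) ≤ g 1 x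
  deriv_le : ∀ x ∈ S, g 1 x ≤ σ

theorem iteratedDeriv_ofReal_eq {U : Set ℝ} (hU : IsOpen U) {g : ℕ → ℝ → ℝ}
    (hg : ∀ k, ∀ x ∈ U, HasDerivAt (g k) (g (k + 1) x) x) (i k : ℕ) :
    ∀ x ∈ U, iteratedDeriv k (fun y => (g i y : ℂ)) x = g (i + k) x := by
  induction k with
  | zero => simp
  | succ k ih =>
    intro x hx
    rw [iteratedDeriv_succ]
    have h : iteratedDeriv k (fun y => (g i y : ℂ)) =ᶠ[nhds x] fun y => (g (i + k) y : ℂ) := by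
      filter_upwards [hU.mem_nhds hx] with y hy using ih y hy
    rw [h.deriv_eq]
    exact (hg (i + k) x hx).ofReal_comp.deriv

theorem iteratedDeriv_add_const_ofReal {f : ℝ → ℂ} (c : ℂ) {k : ℕ} (hk : k ≠ 0) (x : ℝ) :
    iteratedDeriv k (fun y => c + f y) x = iteratedDeriv k f x := by
  obtain ⟨k, rfl⟩ := Nat.exists_eq_succ_of_ne_zero hk
  rw [iteratedDeriv_succ', iteratedDeriv_succ']
  congr 1
  ext y
  simp

theorem DerivBound.pow {N : ℕ} {r A x : ℝ} {f : ℝ → ℂ} (hr : 0 ≤ r)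
    (hf : ContDiffAt ℝ ∞ f x) (hA : DerivBound N r A f x) (p : ℕ) :
    DerivBound N r ((2 ^ N * A) ^ p) (fun y => f y ^ p) x := by
  induction p with
  | zero =>
    intro j _
    rcases Nat.eq_zero_or_pos j with rfl | hj
    · simp
    · simp only [pow_zero, iteratedDeriv_const, hj.ne', if_false, norm_zero, one_mul]
      positivity
  | succ p ih =>
    have := DerivBound.mul hr (hf.pow p) hf ih hA
    simpa only [pow_succ, show 2 ^ N * (2 ^ N * A) ^ p * A = (2 ^ N * A) ^ p * (2 ^ N * A) by ring]
      using this

theorem exists_derivBound_dyadicWindow (N : ℕ) :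
    ∃ M : ℝ, 0 ≤ M ∧ ∀ r x : ℝ, 0 ≤ r →
      DerivBound N r M (fun y => (dyadicWindow (r * y) : ℂ)) x := by
  set w : ℝ → ℂ := fun y => (dyadicWindow y : ℂ) with hw
  have hws : ContDiff ℝ ∞ w := Complex.ofRealCLM.contDiff.comp contDiff_dyadicWindow
  have hwc : HasCompactSupport w := HasCompactSupport.intro (isCompact_Icc (a := (1 / 2 : ℝ)) (b := 2))
    fun x hx => by simp [hw, dyadicWindow_of_notMem hx]
  have h : ∀ j : ℕ, ∃ C : ℝ, ∀ x, ‖iteratedDeriv j w x‖ ≤ C := fun j => by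
    obtain ⟨C, hC⟩ := (hws.continuous_iteratedFDeriv (m := j)
      (mod_cast le_top)).bounded_above_of_compact_support (hwc.iteratedFDeriv j)
    exact ⟨C, fun x => by rw [← norm_iteratedFDeriv_eq_norm_iteratedDeriv]; exact hC x⟩
  choose C hC using h
  have hC0 : ∀ j, 0 ≤ C j := fun j => (norm_nonneg _).trans (hC j 0)
  refine ⟨∑ j ∈ Finset.range (N + 1), C j, Finset.sum_nonneg fun j _ => hC0 j,
    fun r x hr j hj => ?_⟩
  have h1 : iteratedDeriv j (fun y => (dyadicWindow (r * y) : ℂ)) x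
      = r ^ j • iteratedDeriv j w (r * x) := by
    have := iteratedDeriv_comp_const_smul (hws.of_le (mod_cast le_top) : ContDiff ℝ j w) r
    exact congrFun this x
  rw [h1, norm_smul, norm_pow, Real.norm_of_nonneg hr, mul_comm]
  gcongr
  exact (hC j _).trans (Finset.single_le_sum (f := C) (fun i _ => hC0 i)
    (Finset.mem_range.2 (Nat.lt_succ_of_le hj)))

/-- For `x ∈ [R/2, 2R]` the weight `1 + |x|` lies between `R/2` and `3R`, which turns the weights
into powers of `R`. The factor `g 1 x` is kept, since it is what the phase derivative will be
compared with. -/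
theorem IsPhaseSlice.abs_phase_le {c σ : ℝ} {Ca Cg : ℕ → ℝ} {S U : Set ℝ} {a : ℝ → ℂ}
    {g : ℕ → ℝ → ℝ} (h : IsPhaseSlice c σ Ca Cg S U a g) (hc : 0 < c) (hCg : ∀ k, 0 ≤ Cg k)
    {N : ℕ} {R : ℝ} (hR : 1 ≤ R) {x : ℝ} (hx : x ∈ S ∩ Icc (R / 2) (2 * R)) {k : ℕ} (hk : k ≤ N) :
    |g k x| ≤ (3 * 2 ^ N * ∑ i ∈ Finset.range (N + 1), Cg i) * R * (1 / R) ^ k * g 1 x := by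
  have hx0 : 0 ≤ x := by linarith [hx.2.1]
  have hg1 : 0 ≤ g 1 x := le_trans (by positivity) (h.le_deriv x hx.1)
  have h1 := h.phase_le k x hx.1
  rw [abs_of_nonneg hx0] at h1
  have h2 : (R / 2) ^ k ≤ (1 + x) ^ k := by gcongr; linarith [hx.2.1]
  have h3 : |g k x| * (R / 2) ^ k ≤ (∑ i ∈ Finset.range (N + 1), Cg i) * (3 * R) * g 1 x := by
    calc _ ≤ |g k x| * (1 + x) ^ k := by gcongr
      _ ≤ Cg k * (1 + x) * g 1 x := h1
      _ ≤ _ := by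
        gcongr
        · exact Finset.sum_nonneg fun i _ => hCg i
        · exact Finset.single_le_sum (f := Cg) (fun i _ => hCg i)
            (Finset.mem_range.2 (Nat.lt_succ_of_le hk))
        · linarith [hx.2.2]
  have hRp : 0 < R := by linarith
  have hsum : 0 ≤ ∑ i ∈ Finset.range (N + 1), Cg i := Finset.sum_nonneg fun i _ => hCg i
  calc |g k x| = |g k x| * (R / 2) ^ k * (2 ^ k * (1 / R) ^ k) := by
        rw [← mul_pow, mul_assoc, ← mul_pow]; field_simp; simp
    _ ≤ ((∑ i ∈ Finset.range (N + 1), Cg i) * (3 * R) * g 1 x) * (2 ^ N * (1 / R) ^ k) := by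
        gcongr
        norm_num
    _ = _ := by ring

theorem IsPhaseSlice.derivBound_amp {c σ : ℝ} {Ca Cg : ℕ → ℝ} {S U : Set ℝ} {a : ℝ → ℂ}
    {g : ℕ → ℝ → ℝ} (h : IsPhaseSlice c σ Ca Cg S U a g) (hCa : ∀ k, 0 ≤ Ca k)
    {N : ℕ} {R : ℝ} (hR : 1 ≤ R) {x : ℝ} (hx : x ∈ S ∩ Icc (R / 2) (2 * R)) :
    DerivBound N (1 / R) (2 ^ N * ∑ i ∈ Finset.range (N + 1), Ca i) a x := by
  intro k hk
  have hx0 : 0 ≤ x := by linarith [hx.2.1]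
  have hRp : 0 < R := by linarith
  have h1 := h.amp_le k x hx.1
  rw [abs_of_nonneg hx0] at h1
  have h3 : ‖iteratedDeriv k a x‖ * (R / 2) ^ k ≤ ∑ i ∈ Finset.range (N + 1), Ca i := by
    calc _ ≤ ‖iteratedDeriv k a x‖ * (1 + x) ^ k := by gcongr; linarith [hx.2.1]
      _ ≤ Ca k := h1
      _ ≤ _ := Finset.single_le_sum (f := Ca) (fun i _ => hCa i)
            (Finset.mem_range.2 (Nat.lt_succ_of_le hk))
  have hsum : 0 ≤ ∑ i ∈ Finset.range (N + 1), Ca i := Finset.sum_nonneg fun i _ => hCa i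
  calc ‖iteratedDeriv k a x‖ = ‖iteratedDeriv k a x‖ * (R / 2) ^ k * (2 ^ k * (1 / R) ^ k) := by
        rw [← mul_pow, mul_assoc, ← mul_pow]; field_simp; simp
    _ ≤ (∑ i ∈ Finset.range (N + 1), Ca i) * (2 ^ N * (1 / R) ^ k) := by
        gcongr
        norm_num
    _ = _ := by ring

theorem derivBound_ofReal {N : ℕ} {R x : ℝ} (hR : 1 ≤ R) (hx : |x| ≤ 2 * R) :
    DerivBound N (1 / R) (2 * R) (fun y => (y : ℂ)) x := by
  intro j _
  rcases j with _ | _ | j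
  · simpa using hx
  · have hd : HasDerivAt (fun y : ℝ => (y : ℂ)) 1 x := by
      simpa using (hasDerivAt_id x).ofReal_comp
    rw [iteratedDeriv_one, hd.deriv]
    simp only [norm_one, zero_add, pow_one]
    field_simp
    norm_num
  · have hd : deriv (fun y : ℝ => (y : ℂ)) = fun _ => 1 := by
      ext y
      have : HasDerivAt (fun y : ℝ => (y : ℂ)) 1 y := by simpa using (hasDerivAt_id y).ofReal_comp
      exact this.deriv
    rw [iteratedDeriv_succ', hd, iteratedDeriv_const]
    simp only [Nat.add_eq_zero_iff, one_ne_zero, and_false, if_false, norm_zero]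
    positivity

theorem DerivBound.add {N : ℕ} {r A B x : ℝ} {f g : ℝ → ℂ}
    (hf : ContDiffAt ℝ ∞ f x) (hg : ContDiffAt ℝ ∞ g x)
    (hA : DerivBound N r A f x) (hB : DerivBound N r B g x) :
    DerivBound N r (A + B) (fun y => f y + g y) x := by
  intro j hj
  rw [iteratedDeriv_fun_add (hf.of_le (mod_cast le_top)) (hg.of_le (mod_cast le_top)), add_mul]
  exact (norm_add_le _ _).trans (add_le_add (hA j hj) (hB j hj))

theorem DerivBound.const_mul {N : ℕ} {r A x : ℝ} {f : ℝ → ℂ} (c : ℂ)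
    (hA : DerivBound N r A f x) :
    DerivBound N r (‖c‖ * A) (fun y => c * f y) x := by
  intro j hj
  rw [iteratedDeriv_const_mul_field, norm_mul, mul_assoc]
  exact mul_le_mul_of_nonneg_left (hA j hj) (norm_nonneg _)

/-! ### Dyadic blocks of a slice. -/

/-- The amplitude of a dyadic block after `p` derivatives in `t`. -/
noncomputable def blockAmplitude (p : ℕ) (r : ℝ) (a : ℝ → ℂ) (g : ℝ → ℝ) (x : ℝ) : ℂ :=
  (dyadicWindow (r * x) : ℂ) * a x * (Complex.I * (x + g x)) ^ p

theorem blockAmplitude_support {p : ℕ} {R : ℝ} (hR : 0 < R) {S : Set ℝ} (hS : IsClosed S)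
    {a : ℝ → ℂ} (ha : tsupport a ⊆ S) (g : ℝ → ℝ) :
    tsupport (blockAmplitude p (1 / R) a g) ⊆ S ∩ Icc (R / 2) (2 * R) := by
  refine closure_minimal (fun x hx => ⟨ha (subset_tsupport _ fun h0 => hx ?_), ?_⟩)
    (hS.inter isClosed_Icc)
  · simp [blockAmplitude, h0]
  · by_contra hx'
    refine hx ?_
    have : dyadicWindow (1 / R * x) = 0 := by
      refine dyadicWindow_of_notMem fun h => hx' ?_
      rw [mem_Icc, one_div_mul_eq_div, le_div_iff₀ hR, div_le_iff₀ hR] at h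
      exact ⟨by linarith, h.2⟩
    rw [blockAmplitude, this]
    simp

section Blocks

variable {c σ : ℝ} {Ca Cg : ℕ → ℝ}

theorem IsPhaseSlice.contDiffAt_ofReal {S U : Set ℝ} {a : ℝ → ℂ} {g : ℕ → ℝ → ℝ}
    (h : IsPhaseSlice c σ Ca Cg S U a g) {x : ℝ} (hx : x ∈ U) :
    ContDiffAt ℝ ∞ (fun y => (g 0 y : ℂ)) x :=
  Complex.ofRealCLM.contDiff.contDiffAt.comp x
    (h.contDiffOn_phase.contDiffAt (h.isOpen.mem_nhds hx))

theorem IsPhaseSlice.contDiff_blockAmplitude {S U : Set ℝ} {a : ℝ → ℂ} {g : ℕ → ℝ → ℝ}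
    (h : IsPhaseSlice c σ Ca Cg S U a g) (p : ℕ) {R : ℝ} (hR : 0 < R) :
    ContDiff ℝ ∞ (blockAmplitude p (1 / R) a (g 0)) := by
  refine contDiff_of_contDiffAt_tsupport fun x hx => ?_
  have hxU := h.subset (blockAmplitude_support hR h.isClosed h.tsupport_amp _ hx).1
  have h1 : ContDiff ℝ ∞ fun y : ℝ => (dyadicWindow (1 / R * y) : ℂ) :=
    Complex.ofRealCLM.contDiff.comp (contDiff_dyadicWindow.comp (contDiff_const.mul contDiff_id))
  exact (h1.contDiffAt.mul h.contDiff_amp.contDiffAt).mul ((contDiffAt_const.mul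
    (Complex.ofRealCLM.contDiff.contDiffAt.add (h.contDiffAt_ofReal hxU))).pow p)

/-- Each derivative in `t` brings down a factor `i (x + g 0 x)` of size `O(R)`; for `g 0` this uses
`g 1 ≤ σ ≤ 1`. The constant `M` is chosen before the slice, so it serves all rows `m` at once. -/
theorem exists_derivBound_blockAmplitude (hc : 0 < c) (hσ : σ ≤ 1) (hCa : ∀ k, 0 ≤ Ca k)
    (hCg : ∀ k, 0 ≤ Cg k) (p N : ℕ) :
    ∃ M : ℝ, 0 ≤ M ∧ ∀ (S U : Set ℝ) (a : ℝ → ℂ) (g : ℕ → ℝ → ℝ),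
      IsPhaseSlice c σ Ca Cg S U a g → ∀ R : ℝ, 1 ≤ R → ∀ x ∈ S ∩ Icc (R / 2) (2 * R),
      DerivBound N (1 / R) (M * R ^ p) (blockAmplitude p (1 / R) a (g 0)) x := by
  obtain ⟨M₁, hM₁, h₁⟩ := exists_derivBound_dyadicWindow N
  set M₂ : ℝ := 2 ^ N * ∑ i ∈ Finset.range (N + 1), Ca i with hM₂
  set M₃ : ℝ := 3 * 2 ^ N * ∑ i ∈ Finset.range (N + 1), Cg i with hM₃
  have hM₂0 : 0 ≤ M₂ := mul_nonneg (by positivity) (Finset.sum_nonneg fun i _ => hCa i)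
  have hM₃0 : 0 ≤ M₃ := mul_nonneg (by positivity) (Finset.sum_nonneg fun i _ => hCg i)
  refine ⟨2 ^ N * (2 ^ N * M₁ * M₂) * (2 ^ N * (2 + M₃)) ^ p, by positivity, ?_⟩
  intro S U a g h R hR x hx
  have hRp : 0 < R := by linarith
  have hr : 0 ≤ 1 / R := by positivity
  have hxU := h.subset hx.1
  have hw : ContDiff ℝ ∞ fun y : ℝ => (dyadicWindow (1 / R * y) : ℂ) :=
    Complex.ofRealCLM.contDiff.comp (contDiff_dyadicWindow.comp (contDiff_const.mul contDiff_id))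
  have hid : ContDiffAt ℝ ∞ (fun y : ℝ => (y : ℂ)) x := Complex.ofRealCLM.contDiff.contDiffAt
  have hg := h.contDiffAt_ofReal hxU
  have hgb : DerivBound N (1 / R) (M₃ * R) (fun y => (g 0 y : ℂ)) x := by
    intro k hk
    rw [iteratedDeriv_ofReal_eq h.isOpen h.hasDerivAt_phase 0 k x hxU, Complex.norm_real,
      Real.norm_eq_abs, zero_add]
    have hg1 : 0 ≤ g 1 x := le_trans (by positivity) (h.le_deriv x hx.1)
    refine (h.abs_phase_le hc hCg hR hx hk).trans ?_
    exact mul_le_of_le_one_right (by positivity) ((h.deriv_le x hx.1).trans hσ)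
  have hsum := DerivBound.add hid hg (derivBound_ofReal (N := N) hR
    (by rw [abs_of_nonneg (by linarith [hx.2.1])]; exact hx.2.2)) hgb
  have hI := hsum.const_mul Complex.I
  have hpow := hI.pow hr (contDiffAt_const.mul (hid.add hg)) p
  have := ((h₁ (1 / R) x hr).mul hr hw.contDiffAt h.contDiff_amp.contDiffAt
    (h.derivBound_amp hCa hR hx)).mul hr (hw.contDiffAt.mul h.contDiff_amp.contDiffAt)
    ((contDiffAt_const.mul (hid.add hg)).pow p) hpow
  refine this.mono hr le_rfl (le_of_eq ?_)
  rw [Complex.norm_I, one_mul, ← add_mul, ← mul_assoc (2 ^ N) (2 + M₃) R, mul_pow _ R p]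
  ring

theorem norm_cexp_I_mul_ofReal (y : ℝ) : ‖Complex.exp (Complex.I * (y : ℂ))‖ = 1 := by
  rw [mul_comm]; exact Complex.norm_exp_ofReal_mul_I y

/-- Poisson summation and non-stationary phase for a dyadic block of a slice. -/
theorem exists_norm_tsum_block_le (hc : 0 < c) (hσ : σ ≤ 1) (hCa : ∀ k, 0 ≤ Ca k)
    (hCg : ∀ k, 0 ≤ Cg k) {δ : ℝ} (hδ : 0 < δ) {t₁ : ℝ} (ht₁ : 0 ≤ t₁) (p : ℕ) :
    ∃ B : ℝ, 0 ≤ B ∧ ∀ (S U : Set ℝ) (a : ℝ → ℂ) (g : ℕ → ℝ → ℝ),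
      IsPhaseSlice c σ Ca Cg S U a g → ∀ R t : ℝ, 1 ≤ R → 0 ≤ t → t ≤ t₁ →
      (∀ s, 0 < s → s ≤ σ → ∀ k : ℤ,
        δ * s * (1 + |(k : ℝ)|) ≤ |t * (1 + s) - 2 * Real.pi * k|) →
      ‖∑' n : ℤ, blockAmplitude p (1 / R) a (g 0) n *
        Complex.exp (Complex.I * ((t * (n + g 0 n) : ℝ) : ℂ))‖ ≤ B / R ^ 2 := by
  -- Three integrations by parts gain a factor `1/R`, so `3q` of them gain `R^{-(p+3)}`. Of this,
  -- `R^p` pays for the `t`-derivatives and one `R` for the length of the window, leaving `R^{-2}`.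
  set q : ℕ := p + 3 with hq
  set N : ℕ := 3 * q with hN
  obtain ⟨M, hM, hamp⟩ := exists_derivBound_blockAmplitude hc hσ hCa hCg p N
  set M₃ : ℝ := 3 * 2 ^ (N + 1) * ∑ i ∈ Finset.range (N + 1 + 1), Cg i with hM₃
  have hM₃0 : 0 ≤ M₃ := mul_nonneg (by positivity) (Finset.sum_nonneg fun i _ => hCg i)
  set A : ℝ := 1 + t₁ * M₃ / δ with hA
  have hA0 : 0 ≤ A := by positivity
  obtain ⟨D, hD, hns⟩ := norm_integral_mul_le_of_nonstationary N A hA0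
  set V : ℝ := D * M * (9 / (δ * c) ^ 3) ^ q * 2 with hV
  have hV0 : 0 ≤ V := by positivity
  refine ⟨V * ∑' k : ℤ, ((1 + |(k : ℝ)|) ^ 2)⁻¹,
    mul_nonneg hV0 (tsum_nonneg fun k => by positivity), ?_⟩
  intro S U a g h R t hR ht0 ht hgap
  have hRp : 0 < R := by linarith
  have hr : 0 ≤ 1 / R := by positivity
  set b := blockAmplitude p (1 / R) a (g 0) with hb
  set K : Set ℝ := S ∩ Icc (R / 2) (2 * R) with hK
  have hKc : IsCompact K := isCompact_Icc.inter_left h.isClosed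
  have hKU : K ⊆ U := fun x hx => h.subset hx.1
  have hbK : tsupport b ⊆ K := blockAmplitude_support hRp h.isClosed h.tsupport_amp _
  have hbs : ContDiff ℝ ∞ b := h.contDiff_blockAmplitude p hRp
  have hvol : volume.real K ≤ 2 * R := by
    calc volume.real K ≤ volume.real (Icc (R / 2) (2 * R)) :=
          measureReal_mono inter_subset_right isCompact_Icc.measure_lt_top.ne
      _ = 2 * R - R / 2 := by rw [Real.volume_real_Icc_of_le (by linarith)]
      _ ≤ 2 * R := by linarith
  set F : ℝ → ℂ := fun x => b x * Complex.exp (Complex.I * ((t * (x + g 0 x) : ℝ) : ℂ)) with hF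
  have hFsupp : tsupport F ⊆ tsupport b := closure_mono fun x hx h0 => hx (by simp [hF, h0])
  have hFs : ContDiff ℝ ∞ F := contDiff_of_contDiffAt_tsupport fun x hx => by
    refine hbs.contDiffAt.mul (ContDiffAt.cexp (contDiffAt_const.mul ?_))
    exact Complex.ofRealCLM.contDiff.contDiffAt.comp x (contDiffAt_const.mul (contDiffAt_id.add
      (h.contDiffOn_phase.contDiffAt (h.isOpen.mem_nhds (hKU (hbK (hFsupp hx)))))))
  have hFc : HasCompactSupport F :=
    hKc.of_isClosed_subset (isClosed_tsupport _) (hFsupp.trans hbK)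
  have hmain := norm_tsum_int_le_of_fourier hFs hFc
    (B := fun k => V / R ^ 2 * ((1 + |(k : ℝ)|) ^ 2)⁻¹)
    (summable_int_inv_one_add_abs_sq.mul_left _) ?_
  · refine hmain.trans (le_of_eq ?_)
    rw [tsum_mul_left]
    ring
  intro k
  -- This is `i` times the derivative of the phase twisted by the Poisson frequency `2πk`. Keeping
  -- the constant part separate makes its higher derivatives immediate.
  set Θ : ℝ → ℂ := fun x => Complex.I * (((t - 2 * Real.pi * k : ℝ) : ℂ) + (t : ℂ) * (g 1 x : ℂ))
    with hΘ
  have hΘeq : ∀ x, Θ x = Complex.I * ((t * (1 + g 1 x) - 2 * Real.pi * k : ℝ) : ℂ) := fun x => by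
    simp only [hΘ]; push_cast; ring
  have hΘnorm : ∀ x, ‖Θ x‖ = |t * (1 + g 1 x) - 2 * Real.pi * k| := fun x => by
    rw [hΘeq, norm_mul, Complex.norm_I, one_mul, Complex.norm_real, Real.norm_eq_abs]
  set E : ℝ → ℂ := fun x =>
    Complex.exp (Complex.I * ((t * (x + g 0 x) - 2 * Real.pi * k * x : ℝ) : ℂ)) with hE
  have hEF : ∀ x, Complex.exp (↑(-2 * Real.pi * x * k) * Complex.I) • F x = b x * E x := fun x => by
    simp only [hF, hE, smul_eq_mul]
    rw [mul_left_comm, ← Complex.exp_add]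
    congr 2
    push_cast
    ring
  simp_rw [hEF]
  -- On the window `1 + |x| ≤ 3R`, so ellipticity gives `g 1 x ≥ c (3R)^{-2/3}`.
  set l : ℝ := δ * c * (3 * R) ^ (-2 / 3 : ℝ) * (1 + |(k : ℝ)|) with hl
  have hl0 : 0 < l := by positivity
  have hg1pos : ∀ x ∈ K, 0 < g 1 x := fun x hx => by
    have : 0 < 1 + |x| := by positivity
    exact lt_of_lt_of_le (by positivity) (h.le_deriv x hx.1)
  have hgapx : ∀ x ∈ K, δ * g 1 x * (1 + |(k : ℝ)|) ≤ ‖Θ x‖ := fun x hx => by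
    rw [hΘnorm]
    exact hgap _ (hg1pos x hx) (h.deriv_le x hx.1) k
  have hΘs : ContDiffOn ℝ ∞ Θ U := by
    have h1 : ContDiffOn ℝ ∞ (g 1) U := by
      refine ((contDiffOn_infty_iff_deriv_of_isOpen h.isOpen).1 h.contDiffOn_phase).2.congr
        fun x hx => ?_
      exact (h.hasDerivAt_phase 0 x hx).deriv.symm
    exact contDiffOn_const.mul (contDiffOn_const.add (contDiffOn_const.mul
      (Complex.ofRealCLM.contDiff.comp_contDiffOn h1)))
  have hns' := hns K U (1 / R) l (M * R ^ p) Θ E b hKc h.isOpen hKU hr hl0 (by positivity) hΘs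
    ?_ ?_ ?_ ?_ hbs hbK (hamp S U a g h R hR)
  -- The cube of `(1/R) / l` removes the fractional exponent and equals a constant times `R^{-1} (1
  -- + |k|)^{-3}`. Two of the powers of `1 + |k|` suffice to sum over `k`.
  · have hrl : (1 / R / l) ^ N ≤ (9 / (δ * c) ^ 3) ^ q * (1 / R) ^ q * ((1 + |(k : ℝ)|) ^ 2)⁻¹ := by
      have h3R : ((3 * R) ^ (-2 / 3 : ℝ)) ^ 3 = 1 / (9 * R ^ 2) := by
        rw [← Real.rpow_natCast, ← Real.rpow_mul (by positivity)]
        norm_num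
        ring
      have hk1 : 1 ≤ 1 + |(k : ℝ)| := by linarith [abs_nonneg (k : ℝ)]
      have e1 : (1 / R / l) ^ 3 = 9 / (δ * c) ^ 3 * (1 / R) * ((1 + |(k : ℝ)|) ^ 3)⁻¹ := by
        rw [hl, div_pow, mul_pow, mul_pow, h3R]
        field_simp
      rw [hN, pow_mul, e1, mul_pow, mul_pow]
      gcongr
      rw [inv_pow, ← pow_mul]
      gcongr
      omega
    calc _ ≤ _ := hns'
      _ ≤ D * (M * R ^ p) * ((9 / (δ * c) ^ 3) ^ q * (1 / R) ^ q * ((1 + |(k : ℝ)|) ^ 2)⁻¹)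
          * (2 * R) := by gcongr
      _ = _ := by
        have e2 : R ^ p * (1 / R) ^ p = 1 := by rw [← mul_pow]; field_simp; simp
        have e3 : (1 / R) ^ 3 * R = 1 / R ^ 2 := by field_simp
        calc _ = D * M * (9 / (δ * c) ^ 3) ^ q * 2 * ((1 + |(k : ℝ)|) ^ 2)⁻¹
              * (R ^ p * (1 / R) ^ p) * ((1 / R) ^ 3 * R) := by rw [hq, pow_add (1 / R) p 3]; ring
          _ = _ := by rw [e2, e3, hV]; ring
  · intro x hx
    have h1 : HasDerivAt (fun y : ℝ => t * (y + g 0 y) - 2 * Real.pi * k * y)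
        (t * (1 + g 1 x) - 2 * Real.pi * k) x := by
      have := (((hasDerivAt_id x).fun_add (h.hasDerivAt_phase 0 x hx)).const_mul t).fun_sub
        ((hasDerivAt_id x).const_mul (2 * Real.pi * k))
      simpa using this
    have := (h1.ofReal_comp.const_mul Complex.I).cexp
    rw [hΘeq, mul_comm]
    exact this
  · exact fun x _ => (norm_cexp_I_mul_ofReal _).le
  · intro x hx
    refine le_trans ?_ (hgapx x hx)
    have hx0 : 0 ≤ x := by linarith [hx.2.1]
    have h1 : (3 * R) ^ (-2 / 3 : ℝ) ≤ (1 + |x|) ^ (-2 / 3 : ℝ) := by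
      refine Real.rpow_le_rpow_of_nonpos (by positivity) ?_ (by norm_num)
      rw [abs_of_nonneg hx0]
      linarith [hx.2.2]
    have h2 : c * (3 * R) ^ (-2 / 3 : ℝ) ≤ g 1 x :=
      (mul_le_mul_of_nonneg_left h1 hc.le).trans (h.le_deriv x hx.1)
    calc l = δ * (c * (3 * R) ^ (-2 / 3 : ℝ)) * (1 + |(k : ℝ)|) := by rw [hl]; ring
      _ ≤ _ := by gcongr
  · intro x hx j hj
    rcases Nat.eq_zero_or_pos j with rfl | hjp
    · simp only [iteratedDeriv_zero, pow_zero, mul_one]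
      refine le_mul_of_one_le_left (norm_nonneg _) ?_
      rw [hA]
      linarith [show 0 ≤ t₁ * M₃ / δ by positivity]
    · have e1 : iteratedDeriv j Θ x = Complex.I * ((t : ℂ) * (g (1 + j) x : ℂ)) := by
        rw [hΘ, iteratedDeriv_const_mul_field, iteratedDeriv_add_const_ofReal _ hjp.ne',
          iteratedDeriv_const_mul_field,
          iteratedDeriv_ofReal_eq h.isOpen h.hasDerivAt_phase 1 j x (hKU hx)]
      rw [e1, norm_mul, norm_mul, Complex.norm_I, one_mul, Complex.norm_real, Complex.norm_real,
        Real.norm_eq_abs, Real.norm_eq_abs, abs_of_nonneg ht0]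
      -- For `j ≥ 1` the constant part of `Θ` disappears. What remains is `t` times the phase
      -- derivative of order `1 + j`, which is `O(R^{-j})` times `g 1 x ≤ ‖Θ x‖ / δ`. The constant
      -- is therefore independent of `R` and `k`.
      have h2 := h.abs_phase_le hc hCg hR hx (show 1 + j ≤ N + 1 by omega)
      have h3 : δ * g 1 x ≤ ‖Θ x‖ := by
        refine le_trans ?_ (hgapx x hx)
        exact le_mul_of_one_le_right (mul_pos hδ (hg1pos x hx)).le
          (by linarith [abs_nonneg (k : ℝ)])
      calc t * |g (1 + j) x| ≤ t₁ * (M₃ * R * (1 / R) ^ (1 + j) * g 1 x) := by gcongr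
        _ = t₁ * M₃ / δ * (δ * g 1 x) * (1 / R) ^ j := by
          rw [pow_add]
          field_simp
        _ ≤ A * ‖Θ x‖ * (1 / R) ^ j := by
          have : t₁ * M₃ / δ ≤ A := by rw [hA]; linarith
          have : 0 ≤ δ * g 1 x := (mul_pos hδ (hg1pos x hx)).le
          gcongr

end Blocks

/-! ### From symbols in two variables to slices. -/

theorem contDiffOn_iterate_partialEta {U : Set (ℝ × ℝ)} (hU : IsOpen U) {G : ℝ × ℝ → ℝ}
    (hG : ContDiffOn ℝ ∞ G U) (k : ℕ) : ContDiffOn ℝ ∞ (partialEta^[k] G) U := by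
  induction k with
  | zero => exact hG
  | succ k ih =>
    rw [Function.iterate_succ_apply']
    exact (ih.fderiv_of_isOpen hU (by simp)).clm_apply contDiffOn_const

theorem hasDerivAt_slice {m η : ℝ} {f : ℝ × ℝ → ℝ} (hf : DifferentiableAt ℝ f (m, η)) :
    HasDerivAt (fun y => f (m, y)) (partialEta f (m, η)) η := by
  have h1 : HasDerivAt (fun y : ℝ => (m, y)) ((0 : ℝ), (1 : ℝ)) η :=
    (hasDerivAt_const η m).prodMk (hasDerivAt_id η)
  exact hf.hasFDerivAt.comp_hasDerivAt η h1

theorem norm_iteratedDeriv_slice_le {χ : ℝ × ℝ → ℂ} (hχ : ContDiff ℝ ∞ χ) (m η : ℝ) (k : ℕ) :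
    ‖iteratedDeriv k (fun y => χ (m, y)) η‖ ≤ ‖iteratedFDeriv ℝ k χ (m, η)‖ := by
  have h1 : (fun y => χ (m, y)) =
      (fun w => χ ((m, 0) + w)) ∘ (ContinuousLinearMap.inr ℝ ℝ ℝ) := by
    ext y; simp
  have h2 : ContDiff ℝ k fun w => χ ((m, 0) + w) :=
    (hχ.comp (contDiff_const.add contDiff_id)).of_le (mod_cast le_top)
  rw [← norm_iteratedFDeriv_eq_norm_iteratedDeriv, h1,
    ContinuousLinearMap.iteratedFDeriv_comp_right _ h2 _ le_rfl, iteratedFDeriv_comp_add_left]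
  refine (ContinuousMultilinearMap.norm_compContinuousLinearMap_le _ _).trans ?_
  have h3 : ‖ContinuousLinearMap.inr ℝ ℝ ℝ‖ ≤ 1 :=
    ContinuousLinearMap.opNorm_le_bound _ zero_le_one fun y => by simp [Prod.norm_def]
  have h4 : ∏ _i : Fin k, ‖ContinuousLinearMap.inr ℝ ℝ ℝ‖ ≤ 1 :=
    Finset.prod_le_one (fun _ _ => norm_nonneg _) fun _ _ => h3
  calc _ ≤ ‖iteratedFDeriv ℝ k χ ((m, 0) + ContinuousLinearMap.inr ℝ ℝ ℝ η)‖ * 1 := by gcongr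
    _ = _ := by simp

theorem IsSymbol.exists_norm_le {E : Type*} [NormedAddCommGroup E] [NormedSpace ℝ E] {a : E → ℂ}
    (h : IsSymbol 0 a) : ∃ C : ℝ, 0 ≤ C ∧ ∀ w, ‖a w‖ ≤ C := by
  obtain ⟨C, hC⟩ := h.2 0
  have h1 : ∀ w, ‖a w‖ ≤ C := fun w => by simpa using hC w
  exact ⟨C, (norm_nonneg _).trans (h1 0), h1⟩

/-- The choice is `2κ ≤ (σ / (|C| + 1))^{3/2}`, with `|C| + 1` to avoid dividing by zero. The bound
`κ ≤ 1` will give `m ≤ n` on the support. -/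
theorem exists_cone_aperture (C : ℝ) {σ : ℝ} (hσ : 0 < σ) :
    ∃ κ : ℝ, 0 < κ ∧ κ ≤ 1 ∧ |C| * (2 * κ) ^ (2 / 3 : ℝ) ≤ σ := by
  have hb : 0 < σ / (|C| + 1) := by positivity
  refine ⟨min 1 ((σ / (|C| + 1)) ^ (3 / 2 : ℝ) / 2), by positivity, min_le_left _ _, ?_⟩
  have h1 : 2 * min 1 ((σ / (|C| + 1)) ^ (3 / 2 : ℝ) / 2) ≤ (σ / (|C| + 1)) ^ (3 / 2 : ℝ) := by
    linarith [min_le_right 1 ((σ / (|C| + 1)) ^ (3 / 2 : ℝ) / 2)]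
  calc _ ≤ |C| * ((σ / (|C| + 1)) ^ (3 / 2 : ℝ)) ^ (2 / 3 : ℝ) := by gcongr
    _ = |C| * (σ / (|C| + 1)) := by rw [← Real.rpow_mul hb.le]; norm_num
    _ ≤ (|C| + 1) * (σ / (|C| + 1)) := by gcongr; linarith
    _ = σ := by field_simp

namespace IsLatticeSumData

variable {κ : ℝ} {ψ : ℝ → ℂ} {χ : ℝ × ℝ → ℂ} {G : ℝ × ℝ → ℝ}

/-- The row `m = 0` drops out because `ψ` is continuous and vanishes on the negative axis. -/
theorem one_le_of_psi_ne_zero (h : IsLatticeSumData κ ψ χ G) {m : ℤ} (hm : ψ m ≠ 0) : 1 ≤ m := by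
  have h0 : ∀ x < 0, ψ x = 0 := fun x hx => by
    by_contra hne
    exact absurd (h.psi_support (subset_tsupport _ hne)) (by simpa using hx)
  have h00 : ψ 0 = 0 := by
    have h1 : Filter.Tendsto ψ (nhdsWithin 0 (Iio 0)) (nhds (ψ 0)) :=
      h.psi_classical.1.1.continuous.continuousAt.mono_left nhdsWithin_le_nhds
    refine tendsto_nhds_unique h1 (tendsto_const_nhds.congr' ?_)
    filter_upwards [self_mem_nhdsWithin] with x hx using (h0 x hx).symm
  by_contra hlt
  rcases eq_or_lt_of_le (show m ≤ 0 by omega) with rfl | hm'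
  · exact hm (by simpa using h00)
  · exact hm (h0 _ (by exact_mod_cast hm'))

theorem mem_cone (h : IsLatticeSumData κ ψ χ G) {p : ℝ × ℝ} (hp : p ∈ amplitudeSupport ψ χ) :
    |p.1| ≤ κ * p.2 := by
  have hsub : tsupport (fun p : ℝ × ℝ => ψ p.1 * χ p) ⊆ tsupport χ :=
    closure_mono fun q hq h0 => hq (by simp [h0])
  exact h.chi_support (hsub hp)

/-- On the part of the support with `ξ ≥ 1` the symbols `(1 + ξ)^{2/3}` are controlled by the
aperture of the cone. -/
theorem rpow_le (h : IsLatticeSumData κ ψ χ G) (hκ : 0 < κ) {m η : ℝ} (hm : 1 ≤ m)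
    (hp : (m, η) ∈ amplitudeSupport ψ χ) :
    0 ≤ η ∧ (1 + |m|) ^ (2 / 3 : ℝ) ≤ (2 * κ) ^ (2 / 3 : ℝ) * (1 + |η|) ^ (2 / 3 : ℝ) := by
  have h1 := h.mem_cone hp
  simp only [abs_of_pos (show 0 < m by linarith)] at h1 ⊢
  have hη : 0 ≤ η := by
    by_contra hneg
    nlinarith
  refine ⟨hη, ?_⟩
  rw [abs_of_nonneg hη, ← Real.mul_rpow (by positivity) (by positivity)]
  gcongr
  -- Here `1 + m ≤ 2m ≤ 2κη`, which is where `m ≥ 1` is used.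
  nlinarith

/-- The symbol bounds on `G` and the ellipticity of `∂_η G` carry the same factor `(1 + |m|)^{2/3}`.
It cancels in the quotient, so all constants are uniform in `m`. -/
theorem exists_isPhaseSlice (h : IsLatticeSumData κ ψ χ G) (hκ : 0 < κ) {C σ : ℝ}
    (hκσ : |C| * (2 * κ) ^ (2 / 3 : ℝ) ≤ σ)
    (hC : ∀ p ∈ amplitudeSupport ψ χ,
      |partialEta G p| ≤ C * (1 + |p.1|) ^ (2 / 3 : ℝ) * (1 + |p.2|) ^ (-2 / 3 : ℝ)) :
    ∃ (c : ℝ) (Ca Cg : ℕ → ℝ) (U : Set (ℝ × ℝ)), 0 < c ∧ (∀ k, 0 ≤ Ca k) ∧ (∀ k, 0 ≤ Cg k) ∧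
      ∀ m : ℝ, 1 ≤ m → IsPhaseSlice c σ Ca Cg {η | (m, η) ∈ amplitudeSupport ψ χ}
        {η | (m, η) ∈ U} (fun η => ψ m * χ (m, η)) (fun k η => (partialEta^[k] G) (m, η)) := by
  obtain ⟨⟨U, hU, hSU, hGU⟩, hGb⟩ := h.G_symbol
  obtain ⟨-, c, hc, hell⟩ := h.dG_elliptic
  obtain ⟨P, hP, hψ⟩ := h.psi_classical.1.exists_norm_le
  obtain ⟨hχs, hχb⟩ := h.chi_classical.1
  choose X hX using hχb
  choose Y hY using hGb 0
  refine ⟨c, fun k => P * |X k|, fun k => |Y k| / c, U, hc, fun k => by positivity,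
    fun k => by positivity, fun m hm => ?_⟩
  have hline : Continuous fun η : ℝ => (m, η) := by fun_prop
  have hlines : ContDiff ℝ ∞ fun η : ℝ => (m, η) := contDiff_const.prodMk contDiff_id
  have hopen : IsOpen {η | (m, η) ∈ U} := hU.preimage hline
  have hslice : ContDiff ℝ ∞ fun η => χ (m, η) := hχs.comp hlines
  have hm0 : 0 ≤ |m| := abs_nonneg m
  have hone : (1 : ℝ) ≤ (1 + |m|) ^ (2 / 3 : ℝ) :=
    Real.one_le_rpow (by linarith) (by norm_num)
  have hlow : ∀ η, (m, η) ∈ amplitudeSupport ψ χ →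
      c * (1 + |m|) ^ (2 / 3 : ℝ) * (1 + |η|) ^ (-2 / 3 : ℝ) ≤ partialEta G (m, η) :=
    fun η hη => hell _ hη
  refine ⟨(isClosed_tsupport _).preimage hline, hopen, fun η hη => hSU hη,
    contDiff_const.mul hslice, ?_, ?_, ?_, ?_, ?_, ?_, ?_⟩
  · exact closure_minimal (fun η hη => subset_tsupport (fun p : ℝ × ℝ => ψ p.1 * χ p) hη)
      ((isClosed_tsupport _).preimage hline)
  · exact hGU.comp hlines.contDiffOn fun η hη => hη
  · intro k η hη
    simp only [Function.iterate_succ_apply']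
    exact hasDerivAt_slice (((contDiffOn_iterate_partialEta hU hGU k).contDiffAt
      (hU.mem_nhds hη)).differentiableAt (by simp))
  · intro k η _
    have hw : |η| ≤ ‖(m, η)‖ := le_max_right _ _
    rw [iteratedDeriv_const_mul_field, norm_mul]
    have h1 : ‖iteratedDeriv k (fun y => χ (m, y)) η‖ * (1 + |η|) ^ k ≤ |X k| := by
      calc _ ≤ ‖iteratedFDeriv ℝ k χ (m, η)‖ * (1 + ‖(m, η)‖) ^ k := by
            gcongr
            exact norm_iteratedDeriv_slice_le hχs m η k
        _ ≤ (X k * (1 + ‖(m, η)‖) ^ (0 - k : ℝ)) * (1 + ‖(m, η)‖) ^ k := by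
            gcongr
            exact hX k _
        _ = X k := by
            rw [zero_sub, Real.rpow_neg (by positivity), Real.rpow_natCast, mul_assoc,
              inv_mul_cancel₀ (by positivity), mul_one]
        _ ≤ |X k| := le_abs_self _
    rw [mul_assoc]
    gcongr
    exact hψ m
  · intro k η hη
    have hη1 : 0 < 1 + |η| := by positivity
    have h1 : |(partialEta^[k] G) (m, η)| ≤
        Y k * (1 + |m|) ^ (2 / 3 : ℝ) * (1 + |η|) ^ (1 / 3 - k : ℝ) := by
      simpa using hY k _ hη
    calc _ ≤ |Y k| * (1 + |m|) ^ (2 / 3 : ℝ) * (1 + |η|) ^ (1 / 3 - k : ℝ) * (1 + |η|) ^ k := by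
          gcongr
          refine h1.trans ?_
          gcongr
          exact le_abs_self _
      _ = |Y k| / c * (1 + |η|) *
          (c * (1 + |m|) ^ (2 / 3 : ℝ) * (1 + |η|) ^ (-2 / 3 : ℝ)) := by
          have e1 : (1 + |η|) ^ (1 / 3 - k : ℝ) * (1 + |η|) ^ k
              = (1 + |η|) * (1 + |η|) ^ (-2 / 3 : ℝ) := by
            rw [← Real.rpow_natCast (1 + |η|) k, ← Real.rpow_add hη1, ← Real.rpow_one_add' hη1.le]
            · norm_num
            · norm_num
          rw [mul_assoc, e1]
          field_simp
      _ ≤ _ := by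
          gcongr
          exact hlow η hη
  -- The growth in `m` is discarded through `(1 + |m|)^{2/3} ≥ 1`; the weaker bound is uniform over
  -- the rows.
  · intro η hη
    refine le_trans ?_ (hlow η hη)
    gcongr
    exact le_mul_of_one_le_right hc.le hone
  · intro η hη
    obtain ⟨hη0, h2⟩ := h.rpow_le hκ hm hη
    have hη1 : 0 < 1 + |η| := by positivity
    calc partialEta G (m, η) ≤ C * (1 + |m|) ^ (2 / 3 : ℝ) * (1 + |η|) ^ (-2 / 3 : ℝ) :=
          (le_abs_self _).trans (hC _ hη)
      _ ≤ |C| * ((2 * κ) ^ (2 / 3 : ℝ) * (1 + |η|) ^ (2 / 3 : ℝ)) * (1 + |η|) ^ (-2 / 3 : ℝ) := by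
          gcongr
          exact le_abs_self _
      _ = |C| * (2 * κ) ^ (2 / 3 : ℝ) * ((1 + |η|) ^ (2 / 3 : ℝ) * (1 + |η|) ^ (-2 / 3 : ℝ)) := by
          ring
      _ = |C| * (2 * κ) ^ (2 / 3 : ℝ) := by
          rw [← Real.rpow_add hη1]
          norm_num
      _ ≤ σ := hκσ

end IsLatticeSumData

/-! ### Dyadic blocks of the lattice sum and smoothness. -/

/-- The `p`-th derivative of the `j`-th dyadic block of the lattice sum. -/
noncomputable def latticeBlock (ψ : ℝ → ℂ) (χ : ℝ × ℝ → ℂ) (G : ℝ × ℝ → ℝ) (p j : ℕ) (t : ℝ) : ℂ :=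
  ∑ m ∈ Finset.Icc (1 : ℤ) (2 ^ (j + 1)), ∑ n ∈ Finset.Icc (1 : ℤ) (2 ^ (j + 1)),
    blockAmplitude p (1 / 2 ^ j) (fun η => ψ m * χ (m, η)) (fun η => G (m, η)) n *
      Complex.exp (Complex.I * ((t * (n + G (m, n)) : ℝ) : ℂ))

theorem hasDerivAt_latticeBlock (ψ : ℝ → ℂ) (χ : ℝ × ℝ → ℂ) (G : ℝ × ℝ → ℝ) (p j : ℕ) (t : ℝ) :
    HasDerivAt (latticeBlock ψ χ G p j) (latticeBlock ψ χ G (p + 1) j t) t := by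
  unfold latticeBlock
  refine HasDerivAt.fun_sum fun m _ => HasDerivAt.fun_sum fun n _ => ?_
  have h1 : HasDerivAt (fun t : ℝ => t * ((n : ℝ) + G (m, n))) (n + G (m, n)) t := by
    simpa using (hasDerivAt_id t).mul_const ((n : ℝ) + G (m, n))
  have := ((h1.ofReal_comp.const_mul Complex.I).cexp).const_mul
    (blockAmplitude p (1 / 2 ^ j) (fun η => ψ m * χ (m, η)) (fun η => G (m, η)) n)
  convert! this using 1
  simp only [blockAmplitude, pow_succ]
  push_cast
  ring

theorem dyadicWindow_eq_zero_of_notMem_Icc {j : ℕ} {n : ℤ}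
    (hn : n ∉ Finset.Icc (1 : ℤ) (2 ^ (j + 1))) : dyadicWindow (1 / 2 ^ j * (n : ℝ)) = 0 := by
  refine dyadicWindow_of_notMem fun h => hn ?_
  have h2 : (0 : ℝ) < 2 ^ j := by positivity
  rw [mem_Icc, one_div_mul_eq_div, le_div_iff₀ h2, div_le_iff₀ h2] at h
  rw [Finset.mem_Icc]
  constructor
  · have : (0 : ℝ) < n := lt_of_lt_of_le (by positivity) h.1
    have : (0 : ℤ) < n := by exact_mod_cast this
    omega
  · have : (n : ℝ) ≤ 2 ^ (j + 1) := by rw [pow_succ, mul_comm]; exact h.2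
    exact_mod_cast this

/-- The terms of the lattice sum tested against `φ`. -/
noncomputable def latticeTerm (ψ : ℝ → ℂ) (χ : ℝ × ℝ → ℂ) (G : ℝ × ℝ → ℝ) (φ : ℝ → ℝ)
    (mn : ℤ × ℤ) : ℂ :=
  ψ (mn.1 : ℝ) * χ ((mn.1 : ℝ), (mn.2 : ℝ)) *
    ∫ t : ℝ, (φ t : ℂ) *
      Complex.exp (Complex.I * ((t * ((mn.2 : ℝ) + G ((mn.1 : ℝ), (mn.2 : ℝ))) : ℝ) : ℂ))

namespace IsLatticeSumData

variable {κ : ℝ} {ψ : ℝ → ℂ} {χ : ℝ × ℝ → ℂ} {G : ℝ × ℝ → ℝ}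

/-- A block has `2^(j+1)` rows, each bounded by `B 4^{-j}`, which leaves a geometric factor
`2^{-j}`. -/
theorem exists_norm_latticeBlock_le (h : IsLatticeSumData κ ψ χ G) (hκ : 0 < κ) {C σ : ℝ}
    (hσ : σ ≤ 1) (hκσ : |C| * (2 * κ) ^ (2 / 3 : ℝ) ≤ σ)
    (hC : ∀ p ∈ amplitudeSupport ψ χ,
      |partialEta G p| ≤ C * (1 + |p.1|) ^ (2 / 3 : ℝ) * (1 + |p.2|) ^ (-2 / 3 : ℝ))
    {δ t₁ : ℝ} (hδ : 0 < δ) (ht₁ : 0 ≤ t₁) (p : ℕ) :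
    ∃ B : ℝ, 0 ≤ B ∧ ∀ t, 0 ≤ t → t ≤ t₁ →
      (∀ s, 0 < s → s ≤ σ → ∀ k : ℤ,
        δ * s * (1 + |(k : ℝ)|) ≤ |t * (1 + s) - 2 * Real.pi * k|) →
      ∀ j, ‖latticeBlock ψ χ G p j t‖ ≤ B * (1 / 2) ^ j := by
  obtain ⟨c, Ca, Cg, U, hc, hCa, hCg, hslice⟩ := h.exists_isPhaseSlice hκ hκσ hC
  obtain ⟨B, hB, hblock⟩ := exists_norm_tsum_block_le hc hσ hCa hCg hδ ht₁ p
  refine ⟨2 * B, by positivity, fun t ht0 ht hgap j => ?_⟩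
  have h1 : ∀ m ∈ Finset.Icc (1 : ℤ) (2 ^ (j + 1)),
      ‖∑ n ∈ Finset.Icc (1 : ℤ) (2 ^ (j + 1)),
        blockAmplitude p (1 / 2 ^ j) (fun η => ψ m * χ (m, η)) (fun η => G (m, η)) n *
        Complex.exp (Complex.I * ((t * (n + G (m, n)) : ℝ) : ℂ))‖ ≤ B / (2 ^ j) ^ 2 := by
    intro m hm
    have hm1 : (1 : ℝ) ≤ m := by exact_mod_cast (Finset.mem_Icc.1 hm).1
    have := hblock _ _ _ _ (hslice m hm1) (2 ^ j) t (one_le_pow₀ one_le_two) ht0 ht hgap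
    rw [tsum_eq_sum (s := Finset.Icc (1 : ℤ) (2 ^ (j + 1)))] at this
    · exact this
    · intro n hn
      rw [blockAmplitude, dyadicWindow_eq_zero_of_notMem_Icc hn]
      simp
  refine (norm_sum_le_of_le _ h1).trans (le_of_eq ?_)
  rw [Finset.sum_const, Int.card_Icc, nsmul_eq_mul]
  have : (((2 : ℤ) ^ (j + 1) + 1 - 1).toNat : ℝ) = 2 ^ (j + 1) := by
    rw [add_sub_cancel_right, show (2 : ℤ) ^ (j + 1) = ((2 ^ (j + 1) : ℕ) : ℤ) by push_cast; rfl,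
      Int.toNat_natCast]
    push_cast
    rfl
  rw [this, one_div, inv_pow, pow_succ]
  field_simp

theorem of_latticeTerm_ne_zero (h : IsLatticeSumData κ ψ χ G) (hκ : 0 < κ) (hκ1 : κ ≤ 1) {φ : ℝ → ℝ}
    {mn : ℤ × ℤ} (hne : latticeTerm ψ χ G φ mn ≠ 0) :
    ((mn.1 : ℝ), (mn.2 : ℝ)) ∈ amplitudeSupport ψ χ ∧ 1 ≤ mn.1 ∧ mn.1 ≤ mn.2 := by
  have h1 : ψ mn.1 * χ (mn.1, mn.2) ≠ 0 := left_ne_zero_of_mul hne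
  have hm : 1 ≤ mn.1 := h.one_le_of_psi_ne_zero (left_ne_zero_of_mul h1)
  have hmem : ((mn.1 : ℝ), (mn.2 : ℝ)) ∈ amplitudeSupport ψ χ :=
    subset_tsupport (fun p : ℝ × ℝ => ψ p.1 * χ p) h1
  refine ⟨hmem, hm, ?_⟩
  have h2 := h.mem_cone hmem
  have hm' : (1 : ℝ) ≤ mn.1 := by exact_mod_cast hm
  simp only [abs_of_pos (show (0 : ℝ) < mn.1 by linarith)] at h2
  have h3 : (mn.1 : ℝ) ≤ mn.2 := by
    rcases le_or_gt 0 (mn.2 : ℝ) with h0 | h0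
    · nlinarith
    · nlinarith
  exact_mod_cast h3

end IsLatticeSumData

theorem continuous_cexp_I_mul_ofReal_mul (x : ℝ) :
    Continuous fun t : ℝ => Complex.exp (Complex.I * ((t * x : ℝ) : ℂ)) := by fun_prop

theorem integrable_ofReal_mul {φ : ℝ → ℝ} (hφ : Continuous φ) (hφc : HasCompactSupport φ)
    {f : ℝ → ℂ} (hf : Continuous f) : Integrable fun t => (φ t : ℂ) * f t :=
  ((Complex.continuous_ofReal.comp hφ).mul hf).integrable_of_hasCompactSupport
    (HasCompactSupport.mul_right (hφc.comp_left (g := ((↑) : ℝ → ℂ)) Complex.ofReal_zero))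

namespace IsLatticeSumData

variable {κ : ℝ} {ψ : ℝ → ℂ} {χ : ℝ × ℝ → ℂ} {G : ℝ × ℝ → ℝ}

/-- The finite box in `latticeBlock` loses nothing: a nonzero term has `1 ≤ m ≤ n`, and the window
forces `n ≤ 2^(j+1)`. -/
theorem hasSum_integral_latticeBlock (h : IsLatticeSumData κ ψ χ G) (hκ : 0 < κ) (hκ1 : κ ≤ 1)
    {φ : ℝ → ℝ} (hφ : Continuous φ) (hφc : HasCompactSupport φ) (j : ℕ) :
    HasSum (fun mn : ℤ × ℤ => (dyadicWindow (mn.2 / 2 ^ j) : ℂ) * latticeTerm ψ χ G φ mn)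
      (∫ t, (φ t : ℂ) * latticeBlock ψ χ G 0 j t) := by
  have h1 : ∫ t, (φ t : ℂ) * latticeBlock ψ χ G 0 j t =
      ∑ mn ∈ Finset.Icc (1 : ℤ) (2 ^ (j + 1)) ×ˢ Finset.Icc (1 : ℤ) (2 ^ (j + 1)),
        (dyadicWindow (mn.2 / 2 ^ j) : ℂ) * latticeTerm ψ χ G φ mn := by
    have h2 : ∀ t, (φ t : ℂ) * latticeBlock ψ χ G 0 j t =
        ∑ mn ∈ Finset.Icc (1 : ℤ) (2 ^ (j + 1)) ×ˢ Finset.Icc (1 : ℤ) (2 ^ (j + 1)),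
          ((dyadicWindow (mn.2 / 2 ^ j) : ℂ) * (ψ mn.1 * χ (mn.1, mn.2))) *
          ((φ t : ℂ) * Complex.exp (Complex.I * ((t * (mn.2 + G (mn.1, mn.2)) : ℝ) : ℂ))) := by
      intro t
      rw [latticeBlock, ← Finset.sum_product', Finset.mul_sum]
      refine Finset.sum_congr rfl fun mn _ => ?_
      rw [blockAmplitude, pow_zero, one_div_mul_eq_div]
      ring
    simp_rw [h2]
    rw [integral_finsetSum _ fun mn _ => (integrable_ofReal_mul hφ hφc
      (continuous_cexp_I_mul_ofReal_mul _)).const_mul _]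
    refine Finset.sum_congr rfl fun mn _ => ?_
    rw [integral_const_mul, latticeTerm]
    ring
  rw [h1]
  refine hasSum_sum_of_ne_finset_zero fun mn hmn => ?_
  by_contra hne
  have hne1 := right_ne_zero_of_mul hne
  obtain ⟨-, hm, hmn'⟩ := h.of_latticeTerm_ne_zero hκ hκ1 hne1
  have hn : mn.2 ∈ Finset.Icc (1 : ℤ) (2 ^ (j + 1)) := by
    by_contra hn
    refine left_ne_zero_of_mul hne ?_
    rw [← one_div_mul_eq_div, dyadicWindow_eq_zero_of_notMem_Icc hn, Complex.ofReal_zero]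
  rw [Finset.mem_Icc] at hn
  exact hmn (Finset.mem_product.2 ⟨Finset.mem_Icc.2 ⟨hm, hmn'.trans hn.2⟩, Finset.mem_Icc.2 hn⟩)

/-- The dyadic blocks sum up to the lattice sum, in the sense of distributions. -/
theorem tendsto_sum_integral_latticeBlock (h : IsLatticeSumData κ ψ χ G) (hκ : 0 < κ)
    (hκ1 : κ ≤ 1) {φ : ℝ → ℝ} (hφ : Continuous φ) (hφc : HasCompactSupport φ) {z : ℂ}
    (hz : HasSum (latticeTerm ψ χ G φ) z) :
    Filter.Tendsto (fun J => ∑ j ∈ Finset.range (J + 1),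
      ∫ t, (φ t : ℂ) * latticeBlock ψ χ G 0 j t) Filter.atTop (nhds z) := by
  -- By telescoping, the partial sums over blocks are the full series weighted by a cut-off that is
  -- at most `1` and tends to `1` termwise. Unconditional convergence then allows dominated
  -- convergence.
  have h1 : ∀ J : ℕ, ∑ j ∈ Finset.range (J + 1), ∫ t, (φ t : ℂ) * latticeBlock ψ χ G 0 j t =
      ∑' mn : ℤ × ℤ, (smoothCutoff (mn.2 / 2 ^ J) : ℂ) * latticeTerm ψ χ G φ mn := by
    intro J
    rw [← (hasSum_sum fun j _ => h.hasSum_integral_latticeBlock hκ hκ1 hφ hφc j).tsum_eq]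
    refine tsum_congr fun mn => ?_
    rw [← Finset.sum_mul]
    by_cases hne : latticeTerm ψ χ G φ mn = 0
    · rw [hne, mul_zero, mul_zero]
    · obtain ⟨-, hm, hmn⟩ := h.of_latticeTerm_ne_zero hκ hκ1 hne
      have hn : (1 : ℝ) ≤ mn.2 := by exact_mod_cast hm.trans hmn
      rw [← sum_range_dyadicWindow hn J, Complex.ofReal_sum]
  simp_rw [h1]
  rw [← hz.tsum_eq]
  refine tendsto_tsum_of_dominated_convergence hz.summable.norm (fun mn => ?_)
    (Filter.Eventually.of_forall fun J mn => ?_)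
  · refine tendsto_const_nhds.congr' ?_
    obtain ⟨J₀, hJ₀⟩ := pow_unbounded_of_one_lt (mn.2 : ℝ) one_lt_two
    filter_upwards [Filter.eventually_ge_atTop J₀] with J hJ
    have : (mn.2 : ℝ) ≤ 2 ^ J := hJ₀.le.trans (pow_le_pow_right₀ one_le_two hJ)
    rw [smoothCutoff_of_le_one ((div_le_one (by positivity)).2 this), Complex.ofReal_one, one_mul]
  · rw [norm_mul, Complex.norm_real]
    exact mul_le_of_le_one_left (norm_nonneg _) (norm_smoothCutoff_le_one _)

/-- Smoothness of the lattice sum on an interval where the phases are non-stationary. -/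
theorem distributionSmoothOn_Ico (h : IsLatticeSumData κ ψ χ G) (hκ : 0 < κ) (hκ1 : κ ≤ 1)
    {C σ : ℝ} (hσ : σ ≤ 1) (hκσ : |C| * (2 * κ) ^ (2 / 3 : ℝ) ≤ σ)
    (hC : ∀ p ∈ amplitudeSupport ψ χ,
      |partialEta G p| ≤ C * (1 + |p.1|) ^ (2 / 3 : ℝ) * (1 + |p.2|) ^ (-2 / 3 : ℝ))
    {δ a b : ℝ} (hδ : 0 < δ) (ha : 0 ≤ a) (hab : a < b)
    (hgap : ∀ t ∈ Ico a b, ∀ s, 0 < s → s ≤ σ → ∀ k : ℤ,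
        δ * s * (1 + |(k : ℝ)|) ≤ |t * (1 + s) - 2 * Real.pi * k|)
    {Z : 𝓓'((⊤ : Opens ℝ), ℂ)} (hZ : IsLatticeSum Z ψ χ G) :
    DistributionSmoothOn Z (Ico a b) := by
  have hB := fun p => h.exists_norm_latticeBlock_le hκ hσ hκσ hC hδ (ha.trans hab.le) p
  choose B hB0 hB using hB
  have hbound : ∀ p j, ∀ t ∈ Ico a b, ‖latticeBlock ψ χ G p j t‖ ≤ B p * (1 / 2) ^ j :=
    fun p j t ht => hB p t (ha.trans ht.1) ht.2.le (hgap t ht) j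
  have hsum : ∀ p, Summable fun j : ℕ => B p * (1 / 2 : ℝ) ^ j := fun p =>
    summable_geometric_two.mul_left _
  refine ⟨_, contDiffOn_tsum_Ico hab (hasDerivAt_latticeBlock ψ χ G) hsum hbound, ?_⟩
  intro φ hφ
  rw [interior_Ico] at hφ
  have hφ0 : ∀ t, t ∉ Ico a b → φ t = 0 := fun t ht =>
    image_eq_zero_of_notMem_tsupport fun h' => ht (Ioo_subset_Ico_self (hφ h'))
  have hcont : ∀ j, Continuous (latticeBlock ψ χ G 0 j) := fun j =>
    continuous_iff_continuousAt.2 fun t => (hasDerivAt_latticeBlock ψ χ G 0 j t).continuousAt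
  have hint : ∀ j, Integrable fun t => (φ t : ℂ) * latticeBlock ψ χ G 0 j t := fun j =>
    integrable_ofReal_mul φ.continuous φ.hasCompactSupport (hcont j)
  have hφi : Integrable fun t => ‖φ t‖ :=
    (φ.continuous.integrable_of_hasCompactSupport φ.hasCompactSupport).norm
  have hnorm : Summable fun j => ∫ t, ‖(φ t : ℂ) * latticeBlock ψ χ G 0 j t‖ := by
    refine Summable.of_nonneg_of_le (fun j => integral_nonneg fun t => norm_nonneg _)
      (fun j => ?_) ((hsum 0).mul_right (∫ t, ‖φ t‖))
    rw [← integral_const_mul]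
    refine integral_mono (hint j).norm (hφi.const_mul _) fun t => ?_
    by_cases ht : t ∈ Ico a b
    · simp only [norm_mul, Complex.norm_real]
      rw [mul_comm]
      gcongr
      exact hbound 0 j t ht
    · simp [hφ0 t ht]
  have hs := hasSum_integral_of_summable_integral_norm hint hnorm
  simp_rw [tsum_mul_left] at hs
  -- The same partial sums converge to `Z φ` and to the integral of `φ` against the sum of the
  -- blocks.
  exact tendsto_nhds_unique (h.tendsto_sum_integral_latticeBlock hκ hκ1 φ.continuous
    φ.hasCompactSupport (hZ φ)) ((Filter.tendsto_add_atTop_iff_nat 1).2 hs.tendsto_sum_nat)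

end IsLatticeSumData

/-! ### Unconditional convergence to a distribution. -/

/-- This is non-stationary phase in `t` with constant `Θ = i x`. The fourth power is what splits
into two powers in `m` and two in `n`, summable over `ℤ²`. -/
theorem exists_norm_integral_mul_cexp_le : ∃ D : ℝ, 0 ≤ D ∧ ∀ (K : Set ℝ) (φ : ℝ → ℝ) (M x : ℝ),
    IsCompact K → ContDiff ℝ ∞ φ → tsupport φ ⊆ K → 0 ≤ M →
    (∀ j ≤ 4, ∀ t, ‖iteratedFDeriv ℝ j φ t‖ ≤ M) → x ≠ 0 →
    ‖∫ t : ℝ, (φ t : ℂ) * Complex.exp (Complex.I * ((t * x : ℝ) : ℂ))‖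
      ≤ D * M * (1 / |x|) ^ 4 * volume.real K := by
  obtain ⟨D, hD, h⟩ := norm_integral_mul_le_of_nonstationary 4 1 zero_le_one
  refine ⟨D, hD, fun K φ M x hK hφ hφK hM hb hx => ?_⟩
  have hnx : ‖Complex.I * (x : ℂ)‖ = |x| := by
    rw [norm_mul, Complex.norm_I, one_mul, Complex.norm_real, Real.norm_eq_abs]
  refine h K univ 1 |x| M (fun _ => Complex.I * (x : ℂ)) _ (fun t => (φ t : ℂ)) hK isOpen_univ
    (subset_univ _) zero_le_one (abs_pos.2 hx) hM contDiffOn_const ?_ ?_ ?_ ?_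
    (Complex.ofRealCLM.contDiff.comp hφ) ?_ ?_
  · intro t _
    have h1 : HasDerivAt (fun t : ℝ => t * x) x t := by simpa using (hasDerivAt_id t).mul_const x
    have := (h1.ofReal_comp.const_mul Complex.I).cexp
    rw [mul_comm]
    exact this
  · exact fun t _ => (norm_cexp_I_mul_ofReal _).le
  · exact fun t _ => hnx.ge
  · intro t _ j _
    rcases Nat.eq_zero_or_pos j with rfl | hj
    · simp
    · simp only [iteratedDeriv_const, hj.ne', if_false, norm_zero, one_mul, one_pow, mul_one]
      exact norm_nonneg _
  · have hsub : tsupport (fun t => (φ t : ℂ)) ⊆ tsupport φ :=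
      closure_mono fun t ht h0 => ht (by simp [h0])
    exact hsub.trans hφK
  · intro t _ j hj
    have h1 := Complex.ofRealLI.norm_iteratedFDeriv_comp_left (x := t) (n := ∞) (i := j)
      hφ.contDiffAt (mod_cast le_top)
    rw [one_pow, mul_one, ← norm_iteratedFDeriv_eq_norm_iteratedDeriv]
    exact h1.le.trans (hb j hj t)

theorem summable_int_prod_inv_sq :
    Summable fun mn : ℤ × ℤ => ((1 + |(mn.1 : ℝ)|) ^ 2)⁻¹ * ((1 + |(mn.2 : ℝ)|) ^ 2)⁻¹ :=
  summable_int_inv_one_add_abs_sq.mul_of_nonneg summable_int_inv_one_add_abs_sq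
    (fun _ => by positivity) fun _ => by positivity

namespace IsLatticeSumData

variable {κ : ℝ} {ψ : ℝ → ℂ} {χ : ℝ × ℝ → ℂ} {G : ℝ × ℝ → ℝ}

/-- In the cone `m^{2/3} n^{1/3}` is at most a small multiple of `1 + n`, and `(1 + n)/4 ≤ n/2` for
`n ≥ 1`. Hence the frequency `n + G` cannot vanish. -/
theorem abs_le_half (h : IsLatticeSumData κ ψ χ G) (hκ : 0 < κ) {C₀ : ℝ}
    (hκC : |C₀| * (2 * κ) ^ (2 / 3 : ℝ) ≤ 1 / 4)
    (hG : ∀ p ∈ amplitudeSupport ψ χ,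
      |G p| ≤ C₀ * (1 + |p.1|) ^ (2 / 3 : ℝ) * (1 + |p.2|) ^ (1 / 3 : ℝ))
    {m n : ℝ} (hm : 1 ≤ m) (hn : 1 ≤ n) (hmem : (m, n) ∈ amplitudeSupport ψ χ) :
    |G (m, n)| ≤ n / 2 := by
  have hn1 : 0 < 1 + |n| := by positivity
  calc |G (m, n)| ≤ C₀ * (1 + |m|) ^ (2 / 3 : ℝ) * (1 + |n|) ^ (1 / 3 : ℝ) := hG _ hmem
    _ ≤ |C₀| * ((2 * κ) ^ (2 / 3 : ℝ) * (1 + |n|) ^ (2 / 3 : ℝ)) * (1 + |n|) ^ (1 / 3 : ℝ) := by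
        gcongr
        · exact le_abs_self _
        · exact (h.rpow_le hκ hm hmem).2
    _ = |C₀| * (2 * κ) ^ (2 / 3 : ℝ) * ((1 + |n|) ^ (2 / 3 : ℝ) * (1 + |n|) ^ (1 / 3 : ℝ)) := by
        ring
    _ = |C₀| * (2 * κ) ^ (2 / 3 : ℝ) * (1 + |n|) := by
        rw [← Real.rpow_add hn1]
        norm_num
    _ ≤ 1 / 4 * (1 + |n|) := by gcongr
    _ ≤ n / 2 := by rw [abs_of_pos (by linarith)]; linarith

theorem exists_norm_latticeTerm_le (h : IsLatticeSumData κ ψ χ G) (hκ : 0 < κ) (hκ1 : κ ≤ 1)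
    {C₀ : ℝ} (hκC : |C₀| * (2 * κ) ^ (2 / 3 : ℝ) ≤ 1 / 4)
    (hG : ∀ p ∈ amplitudeSupport ψ χ,
      |G p| ≤ C₀ * (1 + |p.1|) ^ (2 / 3 : ℝ) * (1 + |p.2|) ^ (1 / 3 : ℝ)) :
    ∃ B : ℝ, 0 ≤ B ∧ ∀ (K : Set ℝ) (φ : ℝ → ℝ) (M : ℝ), IsCompact K → ContDiff ℝ ∞ φ →
      tsupport φ ⊆ K → 0 ≤ M → (∀ j ≤ 4, ∀ t, ‖iteratedFDeriv ℝ j φ t‖ ≤ M) → ∀ mn : ℤ × ℤ,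
      ‖latticeTerm ψ χ G φ mn‖ ≤ B * volume.real K * M *
        (((1 + |(mn.1 : ℝ)|) ^ 2)⁻¹ * ((1 + |(mn.2 : ℝ)|) ^ 2)⁻¹) := by
  obtain ⟨D, hD, hosc⟩ := exists_norm_integral_mul_cexp_le
  obtain ⟨P, hP, hψ⟩ := h.psi_classical.1.exists_norm_le
  obtain ⟨X, hX, hχ⟩ := h.chi_classical.1.exists_norm_le
  refine ⟨P * X * D * 256, by positivity, fun K φ M hK hφ hφK hM hb mn => ?_⟩
  by_cases hne : latticeTerm ψ χ G φ mn = 0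
  · rw [hne, norm_zero]
    positivity
  obtain ⟨hmem, hm, hmn⟩ := h.of_latticeTerm_ne_zero hκ hκ1 hne
  have hm1 : (1 : ℝ) ≤ mn.1 := by exact_mod_cast hm
  have hmn1 : (mn.1 : ℝ) ≤ mn.2 := by exact_mod_cast hmn
  have hn1 : (1 : ℝ) ≤ mn.2 := hm1.trans hmn1
  have hGle := abs_le.1 (h.abs_le_half hκ hκC hG hm1 hn1 hmem)
  have hx : (mn.2 : ℝ) / 2 ≤ mn.2 + G (mn.1, mn.2) := by linarith
  have hx0 : 0 < (mn.2 : ℝ) + G (mn.1, mn.2) := by linarith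
  have h1 := hosc K φ M _ hK hφ hφK hM hb hx0.ne'
  -- The frequency is at least `n/2 ≥ (1 + n)/4 ≥ (1 + m)/4`, and `256 = 4^4`.
  have h2 : (1 / |(mn.2 : ℝ) + G (mn.1, mn.2)|) ^ 4 ≤
      256 * (((1 + |(mn.1 : ℝ)|) ^ 2)⁻¹ * ((1 + |(mn.2 : ℝ)|) ^ 2)⁻¹) := by
    have h3 : 1 / |(mn.2 : ℝ) + G (mn.1, mn.2)| ≤ 4 * (1 + (mn.1 : ℝ))⁻¹ := by
      rw [abs_of_pos hx0, ← div_eq_mul_inv, div_le_div_iff₀ hx0 (by linarith)]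
      linarith
    have h4 : 1 / |(mn.2 : ℝ) + G (mn.1, mn.2)| ≤ 4 * (1 + (mn.2 : ℝ))⁻¹ := by
      rw [abs_of_pos hx0, ← div_eq_mul_inv, div_le_div_iff₀ hx0 (by linarith)]
      linarith
    rw [abs_of_pos (show (0 : ℝ) < mn.1 by linarith), abs_of_pos (show (0 : ℝ) < mn.2 by linarith)]
    calc _ = (1 / |(mn.2 : ℝ) + G (mn.1, mn.2)|) ^ 2 * (1 / |(mn.2 : ℝ) + G (mn.1, mn.2)|) ^ 2 := by
          ring
      _ ≤ (4 * (1 + (mn.1 : ℝ))⁻¹) ^ 2 * (4 * (1 + (mn.2 : ℝ))⁻¹) ^ 2 := by gcongr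
      _ = _ := by rw [mul_pow, mul_pow, inv_pow, inv_pow]; ring
  rw [latticeTerm, norm_mul, norm_mul]
  calc _ ≤ P * X * (D * M * (256 * (((1 + |(mn.1 : ℝ)|) ^ 2)⁻¹ * ((1 + |(mn.2 : ℝ)|) ^ 2)⁻¹))
        * volume.real K) := by
        gcongr
        · exact hψ _
        · exact hχ _
        · exact h1.trans (by gcongr)
    _ = _ := by ring

/-- For a thin cone the lattice sum converges unconditionally to a distribution. -/
theorem exists_isLatticeSum (h : IsLatticeSumData κ ψ χ G) (hκ : 0 < κ) (hκ1 : κ ≤ 1)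
    {C₀ : ℝ} (hκC : |C₀| * (2 * κ) ^ (2 / 3 : ℝ) ≤ 1 / 4)
    (hG : ∀ p ∈ amplitudeSupport ψ χ,
      |G p| ≤ C₀ * (1 + |p.1|) ^ (2 / 3 : ℝ) * (1 + |p.2|) ^ (1 / 3 : ℝ)) :
    ∃ Z : 𝓓'((⊤ : Opens ℝ), ℂ), IsLatticeSum Z ψ χ G := by
  obtain ⟨B, hB, hle⟩ := h.exists_norm_latticeTerm_le hκ hκ1 hκC hG
  set s₀ : ℝ := ∑' mn : ℤ × ℤ, ((1 + |(mn.1 : ℝ)|) ^ 2)⁻¹ * ((1 + |(mn.2 : ℝ)|) ^ 2)⁻¹ with hs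
  have hs0 : 0 ≤ s₀ := tsum_nonneg fun mn => by positivity
  have hsummable : ∀ φ : 𝓓((⊤ : Opens ℝ), ℝ), Summable (latticeTerm ψ χ G φ) := by
    intro φ
    have hb : ∀ j : ℕ, ∃ M, ∀ t, ‖iteratedFDeriv ℝ j φ t‖ ≤ M := fun j =>
      (φ.contDiff.continuous_iteratedFDeriv (m := j)
        (mod_cast le_top)).bounded_above_of_compact_support (φ.hasCompactSupport.iteratedFDeriv j)
    choose M hM using hb
    have hM0 : ∀ j, 0 ≤ M j := fun j => (norm_nonneg _).trans (hM j 0)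
    refine Summable.of_norm_bounded (summable_int_prod_inv_sq.mul_left _)
      (hle (tsupport φ) φ (∑ j ∈ Finset.range 5, M j) φ.hasCompactSupport φ.contDiff Subset.rfl
        (Finset.sum_nonneg fun j _ => hM0 j) fun j hj t => (hM j t).trans
          (Finset.single_le_sum (f := M) (fun i _ => hM0 i) (Finset.mem_range.2 (by omega))))
  have hadd : ∀ f g : 𝓓((⊤ : Opens ℝ), ℝ), ∑' mn, latticeTerm ψ χ G (f + g) mn =
      ∑' mn, latticeTerm ψ χ G f mn + ∑' mn, latticeTerm ψ χ G g mn := by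
    intro f g
    rw [← (hsummable f).tsum_add (hsummable g)]
    refine tsum_congr fun mn => ?_
    simp only [latticeTerm]
    rw [← mul_add, ← integral_add
      (integrable_ofReal_mul f.continuous f.hasCompactSupport (continuous_cexp_I_mul_ofReal_mul _))
      (integrable_ofReal_mul g.continuous g.hasCompactSupport (continuous_cexp_I_mul_ofReal_mul _))]
    congr 2
    ext t
    rw [Pi.add_apply]
    push_cast
    ring
  have hsmul : ∀ (c : ℝ) (f : 𝓓((⊤ : Opens ℝ), ℝ)), ∑' mn, latticeTerm ψ χ G (c • f) mn =
      c • ∑' mn, latticeTerm ψ χ G f mn := by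
    intro c f
    rw [Complex.real_smul, ← tsum_mul_left]
    refine tsum_congr fun mn => ?_
    simp only [latticeTerm]
    rw [mul_left_comm (c : ℂ), ← integral_const_mul (c : ℂ)]
    congr 1
    refine integral_congr_ae (.of_forall fun t => ?_)
    beta_reduce
    rw [Pi.smul_apply, smul_eq_mul]
    push_cast
    ring
  -- Continuity on the inductive limit is checked on each compact `K`. There the summed term bounds
  -- control `Z` by the seminorms of orders `0` to `4`.
  let Z : 𝓓((⊤ : Opens ℝ), ℝ) →L[ℝ] ℂ := TestFunction.limitCLM ℝ
    (fun φ => ∑' mn, latticeTerm ψ χ G φ mn)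
    (fun K hK => ContDiffMapSupportedIn.mkCLMtoNormedSpace ℝ
      (fun f => ∑' mn, latticeTerm ψ χ G (TestFunction.ofSupportedIn hK f) mn)
      (fun f g => hadd (TestFunction.ofSupportedIn hK f) (TestFunction.ofSupportedIn hK g))
      (fun c f => hsmul c (TestFunction.ofSupportedIn hK f))
      ⟨Finset.range 5, B * volume.real (K : Set ℝ) * s₀, by positivity, fun f => by
        have hM : ∀ j ≤ 4, ∀ t, ‖iteratedFDeriv ℝ j f t‖ ≤
            ((Finset.range 5).sup fun i => N[ℝ]_{K, i}) f := fun j hj t =>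
          (ContDiffMapSupportedIn.norm_iteratedFDeriv_apply_le_seminorm_top ℝ).trans
            (Seminorm.le_def.1 (Finset.le_sup (f := fun i => N[ℝ]_{K, i})
              (Finset.mem_range.2 (Nat.lt_succ_of_le hj))) f)
        have := tsum_of_norm_bounded (summable_int_prod_inv_sq.mul_left _).hasSum
          (hle K f _ K.isCompact f.contDiff f.tsupport_subset (apply_nonneg _ _) hM)
        rw [tsum_mul_left] at this
        refine this.trans (le_of_eq ?_)
        ring⟩)
    (fun K hK f => rfl)
  exact ⟨Z, fun φ => (hsummable φ).hasSum⟩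

end IsLatticeSumData

/-! ### Conclusion. -/

theorem DistributionSmoothOn.mono_Ioo {Z : 𝓓'((⊤ : Opens ℝ), ℂ)} {a b : ℝ}
    (h : DistributionSmoothOn Z (Ico a b)) : DistributionSmoothOn Z (Ioo a b) := by
  obtain ⟨f, hf, hZ⟩ := h
  refine ⟨f, hf.mono Ioo_subset_Ico_self, fun φ hφ => hZ φ ?_⟩
  rwa [interior_Ico, ← interior_Ioo]

/-- The first part says that the lattice sum does define a distribution, once the cone is thin
compared with the bound on `G`.  The second part is the smoothness of this distribution. -/
theorem theorem2 :
    (∀ C₀ : ℝ, ∃ κ₀ : ℝ, 0 < κ₀ ∧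
      ∀ (ψ : ℝ → ℂ) (χ : ℝ × ℝ → ℂ) (G : ℝ × ℝ → ℝ), IsLatticeSumData κ₀ ψ χ G →
        (∀ p ∈ amplitudeSupport ψ χ,
          |G p| ≤ C₀ * (1 + |p.1|) ^ (2 / 3 : ℝ) * (1 + |p.2|) ^ (1 / 3 : ℝ)) →
        ∃ Z : 𝓓'((⊤ : TopologicalSpace.Opens ℝ), ℂ), IsLatticeSum Z ψ χ G) ∧
    (∀ T : ℝ, 0 < T → ∀ C : ℝ, ∃ ε κ₁ : ℝ, 0 < ε ∧ 0 < κ₁ ∧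
      ∀ (ψ : ℝ → ℂ) (χ : ℝ × ℝ → ℂ) (G : ℝ × ℝ → ℝ), IsLatticeSumData κ₁ ψ χ G →
        (∀ p ∈ amplitudeSupport ψ χ,
          |partialEta G p| ≤ C * (1 + |p.1|) ^ (2 / 3 : ℝ) * (1 + |p.2|) ^ (-2 / 3 : ℝ)) →
        ∀ Z : 𝓓'((⊤ : TopologicalSpace.Opens ℝ), ℂ), IsLatticeSum Z ψ χ G →
          (∀ ℓ : ℕ, T = 2 * Real.pi * ℓ → DistributionSmoothOn Z (Set.Ico T (T + ε))) ∧
          ((∀ ℓ : ℕ, T ≠ 2 * Real.pi * ℓ) →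
            DistributionSmoothOn Z (Set.Ioo (T - ε) (T + ε)))) := by
  refine ⟨fun C₀ => ?_, fun T hT C => ?_⟩
  · obtain ⟨κ, hκ, hκ1, hκC⟩ := exists_cone_aperture C₀ (σ := 1 / 4) (by norm_num)
    exact ⟨κ, hκ, fun ψ χ G h hG => h.exists_isLatticeSum hκ hκ1 hκC hG⟩
  · obtain ⟨ε, σ, δ, hε, hεT, hσ, hσ1, hδ, hgap⟩ := exists_le_abs_mul_one_add_sub hT
    obtain ⟨κ, hκ, hκ1, hκσ⟩ := exists_cone_aperture C hσ
    refine ⟨ε, κ, hε, hκ, fun ψ χ G h hC Z hZ => ⟨fun _ _ => ?_, fun hℓ => ?_⟩⟩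
    · exact h.distributionSmoothOn_Ico hκ hκ1 hσ1 hκσ hC hδ hT.le (by linarith)
        (fun t ht s hs hsσ k => hgap t s (by linarith [ht.1]) ht.2 hs hsσ k fun _ => ht.1) hZ
    -- When `T ∉ 2πℕ` no `k` is resonant (a negative one is excluded by `T > 0`). The gap then holds
    -- on all of `[T - ε, T + ε)`, which is shrunk to the open interval.
    · refine (h.distributionSmoothOn_Ico hκ hκ1 hσ1 hκσ hC hδ (by linarith) (by linarith)
        (fun t ht s hs hsσ k => hgap t s ht.1 ht.2 hs hsσ k fun hk => ?_) hZ).mono_Ioo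
      have hk0 : 0 ≤ k := by
        by_contra hneg
        have h1 : (k : ℝ) ≤ 0 := by exact_mod_cast (not_le.1 hneg).le
        nlinarith [Real.pi_pos]
      obtain ⟨ℓ, rfl⟩ := Int.eq_ofNat_of_zero_le hk0
      exact absurd hk.symm (by simpa using hℓ ℓ)
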